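/- Let $n\ge 1$ and let $w$ be a weight on $\mathbb R^n$, i.e. a non-negative locally integrable function; write $w(E)=\int_E w(x)\,dx$ for measurable $E\subseteq\mathbb R^n$. For a weight $v$ on $\mathbb R$ put \[ [v]_{A_\infty}=\sup_I \frac1{v(I)}\int_I \mathsf M(v\mathbf 1_I)(t)\,dt,\qquad \mathsf M f(t)=\sup_{I\ni t}\frac1{|I|}\int_I|f|, \] the suprema being over bounded nondegenerate intervals $I$ (with $0/0=0$). For $1\le j\le n$ and $\bar x^j=(x_1,\dots,x_{j-1},x_{j+1},\dots,x_n)\in\mathbb R^{n-1}$ let $w_{\bar x^j}(t)=w(x_1,\dots,x_{j-1},t,x_{j+1},\dots,x_n)$. Assume that $w\in A_\infty^*$ is a strong Muckenhoupt weight, i.e. \[ [w]_{A_\infty^*}=\sup_{1\le j\le n}\ \operatorname*{ess\,sup}_{\bar x^j\in\mathbb R^{n-1}}\,[w_{\bar x^j}]_{A_\infty}<\infty . \] Let $\mathsf M_{\mathsf S,w}f(x)=\sup_{R\ni x}\frac1{w(R)}\int_R|f|\,w\,dy$, where the supremum is over bounded nondegenerate rectangular parallelepipeds $R\ni x$ with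 sides parallel to the coordinate axes (again with $0/0=0$), and for $\alpha\in(0,1)$ let \[ \mathsf C_{\mathsf S,w}^{w}(\alpha)=\sup_{E\subseteq\mathbb R^n \text{ measurable},\ 0<w(E)<\infty}\ \frac{w(\{x\in\mathbb R^n:\ \mathsf M_{\mathsf S,w}(\mathbf 1_E)(x)>\alpha\})}{w(E)} . \] Then there are constants $c_{w,n}>0$, $K_{w,n}>0$ and $\alpha_{w,n}\in(0,1)$, depending only on $w$ and $n$, such that \[ \mathsf C_{\mathsf S,w}^{w}(\alpha)-1\le K_{w,n}\,(1-\alpha)^{c_{w,n}}\qquad\text{for all }\alpha_{w,n}<\alpha<1 . \] -/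

import Mathlib

open MeasureTheory Filter Topology
open scoped ENNReal

noncomputable section

/-- The uncentered Hardy–Littlewood maximal operator on the real line,
`M f (x) = sup_{I ∋ x} |I|⁻¹ ∫_I |f|`, the supremum being over bounded nondegenerate intervals. -/
def maximalOne (f : ℝ → ℝ) (x : ℝ) : ℝ≥0∞ :=
  ⨆ (a : ℝ) (b : ℝ) (_ : a < b) (_ : x ∈ Set.Icc a b),
    (∫⁻ y in Set.Icc a b, ‖f y‖ₑ) / volume (Set.Icc a b)

/-- The measure `w(x) dx` attached to a weight `w` on `ℝⁿ`. -/
def weightMeasure {n : ℕ} (w : (Fin n → ℝ) → ℝ) : Measure (Fin n → ℝ) :=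
  volume.withDensity fun x => ENNReal.ofReal (w x)

/-- The Fujii–Wilson constant of a weight on the real line,
`[v]_{A_∞} = sup_I v(I)⁻¹ ∫_I M(v 1_I)`, over bounded nondegenerate intervals `I`
(an interval on which `v` vanishes almost everywhere contributes `0 / 0 = 0`). -/
def aInftyConst (v : ℝ → ℝ) : ℝ≥0∞ :=
  ⨆ (a : ℝ) (b : ℝ) (_ : a < b),
    (∫⁻ x in Set.Icc a b, maximalOne ((Set.Icc a b).indicator v) x) /
      ∫⁻ x in Set.Icc a b, ENNReal.ofReal (v x)

/-- The one-dimensional slice of `w` in the `j`-th coordinate direction: the `j`-th coordinate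
is the variable `t`, and the other coordinates are given by `y`. -/
def slice {n : ℕ} (w : (Fin n → ℝ) → ℝ) (j : Fin n) (y : {i : Fin n // i ≠ j} → ℝ) : ℝ → ℝ :=
  fun t => w fun i => if h : i = j then t else y ⟨i, h⟩

/-- The strong `A_∞` constant: the supremum over the coordinate directions `j` of the essential
supremum, over the other `n - 1` coordinates, of the `A_∞` constants of the slices. -/
def strongAInftyConst {n : ℕ} (w : (Fin n → ℝ) → ℝ) : ℝ≥0∞ :=
  ⨆ j : Fin n, essSup (fun y : {i : Fin n // i ≠ j} → ℝ => aInftyConst (slice w j y)) volume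

/-- Strong Muckenhoupt weights, the class `A_∞^*`: non-negative locally integrable functions on
`ℝⁿ` with finite strong `A_∞` constant. -/
structure IsStrongAInfty {n : ℕ} (w : (Fin n → ℝ) → ℝ) : Prop where
  nonneg : ∀ x, 0 ≤ w x
  locallyIntegrable : LocallyIntegrable w volume
  const_lt_top : strongAInftyConst w < ∞

/-- The strong maximal operator with respect to `w`,
`M_{S,w} f (x) = sup_{R ∋ x} w(R)⁻¹ ∫_R |f| w`, over bounded nondegenerate rectangular
parallelepipeds `R = ∏ i, [a i, b i]` with sides parallel to the axes. -/
def strongMaximal {n : ℕ} (w : (Fin n → ℝ) → ℝ) (f : (Fin n → ℝ) → ℝ) (x : Fin n → ℝ) : ℝ≥0∞ :=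
  ⨆ (a : Fin n → ℝ) (b : Fin n → ℝ) (_ : ∀ i, a i < b i) (_ : x ∈ Set.Icc a b),
    (∫⁻ y in Set.Icc a b, ‖f y‖ₑ ∂(weightMeasure w)) / weightMeasure w (Set.Icc a b)

/-- The sharp Tauberian constant of `M_{S,w}` with respect to `w`: the supremum of
`w({M_{S,w}(1_E) > α}) / w(E)` over measurable `E` with `0 < w(E) < ∞`. -/
def tauberianConst {n : ℕ} (w : (Fin n → ℝ) → ℝ) (α : ℝ) : ℝ≥0∞ :=
  ⨆ (E : Set (Fin n → ℝ)) (_ : MeasurableSet E)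
    (_ : 0 < weightMeasure w E) (_ : weightMeasure w E < ∞),
    weightMeasure w {x | ENNReal.ofReal α < strongMaximal w (E.indicator fun _ => 1) x} /
      weightMeasure w E

end

/-- A finite family of intervals has a subfamily with the same union and overlap at most two. -/
theorem exists_subset_overlap_le_two (s : Finset ℝ) (l u : ℝ → ℝ) :
    ∃ t ⊆ s, (⋃ x ∈ s, Set.Icc (l x) (u x)) = (⋃ x ∈ t, Set.Icc (l x) (u x)) ∧
      ∀ y, (t.filter fun x => y ∈ Set.Icc (l x) (u x)).card ≤ 2 := by
  induction s using Finset.strongInduction with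
  | H s ih =>
    by_cases hs : ∀ y, (s.filter fun x => y ∈ Set.Icc (l x) (u x)).card ≤ 2
    · exact ⟨s, subset_rfl, rfl, hs⟩
    push Not at hs
    obtain ⟨y, hy⟩ := hs
    set f := s.filter fun x => y ∈ Set.Icc (l x) (u x) with hf
    have hne : f.Nonempty := Finset.card_pos.1 (by omega)
    obtain ⟨p, hp, hpm⟩ := f.exists_min_image l hne
    obtain ⟨q, hq, hqm⟩ := f.exists_max_image u hne
    obtain ⟨z, hz, hzpq⟩ : ∃ z ∈ f, z ∉ ({p, q} : Finset ℝ) := by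
      by_contra! h
      have := Finset.card_le_card (show f ⊆ {p, q} from h)
      have := Finset.card_le_two (a := p) (b := q)
      omega
    have hzs : z ∈ s := (Finset.mem_filter.1 hz).1
    have hps := Finset.mem_filter.1 hp
    have hqs := Finset.mem_filter.1 hq
    simp only [Finset.mem_insert, Finset.mem_singleton, not_or] at hzpq
    obtain ⟨t, hts, htU, ht⟩ := ih (s.erase z) (Finset.erase_ssubset hzs)
    refine ⟨t, hts.trans (Finset.erase_subset _ _), ?_, ht⟩
    rw [← htU]
    refine Set.Subset.antisymm ?_ ?_
    · intro c hc
      simp only [Set.mem_iUnion, exists_prop] at hc ⊢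
      obtain ⟨i, hi, hci⟩ := hc
      by_cases hiz : i = z
      · subst hiz
        have h1 := hpm i hz
        have h2 := hqm i hz
        rcases le_total c y with h | h
        · exact ⟨p, Finset.mem_erase.2 ⟨fun h => hzpq.1 h.symm, hps.1⟩, h1.trans hci.1,
            h.trans hps.2.2⟩
        · exact ⟨q, Finset.mem_erase.2 ⟨fun h => hzpq.2 h.symm, hqs.1⟩, hqs.2.1.trans h,
            hci.2.trans h2⟩
      · exact ⟨i, Finset.mem_erase.2 ⟨hiz, hi⟩, hci⟩
    · exact Set.biUnion_subset_biUnion_left (Finset.erase_subset _ _)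

theorem IsCompact.exists_finset_cover_overlap_le_two {K : Set ℝ} (hK : IsCompact K) (l u : ℝ → ℝ)
    (h : ∀ x ∈ K, Set.Icc (l x) (u x) ∈ 𝓝[K] x) :
    ∃ t : Finset ℝ, (∀ x ∈ t, x ∈ K) ∧ K ⊆ (⋃ x ∈ t, Set.Icc (l x) (u x)) ∧
      ∀ y, (t.filter fun x => y ∈ Set.Icc (l x) (u x)).card ≤ 2 := by
  obtain ⟨s, hsK, hs⟩ := hK.elim_nhdsWithin_subcover _ h
  obtain ⟨t, hts, htU, ht⟩ := exists_subset_overlap_le_two s l u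
  exact ⟨t, fun x hx => hsK x (hts hx), htU ▸ hs, ht⟩

theorem sum_measureReal_le_two_mul {ι : Type*} (t : Finset ι) (J : ι → Set ℝ)
    [∀ y, DecidablePred fun x => y ∈ J x]
    (hJ : ∀ x, MeasurableSet (J x)) (ht : ∀ y, (t.filter fun x => y ∈ J x).card ≤ 2)
    (ν : Measure ℝ) (hfin : ν (⋃ x ∈ t, J x) ≠ ∞) :
    ∑ x ∈ t, ν.real (J x) ≤ 2 * ν.real (⋃ x ∈ t, J x) := by
  have key : ∑ x ∈ t, ν (J x) ≤ 2 * ν (⋃ x ∈ t, J x) := by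
    have h1 : ∀ x, ν (J x) = ∫⁻ y, (J x).indicator (fun _ => (1 : ℝ≥0∞)) y ∂ν := fun x => by
      rw [lintegral_indicator_const (hJ x), one_mul]
    simp_rw [h1]
    rw [← lintegral_finsetSum' _ fun x _ => (measurable_const.indicator (hJ x)).aemeasurable,
      ← lintegral_indicator_const (t.measurableSet_biUnion fun x _ => hJ x)]
    refine lintegral_mono fun y => ?_
    by_cases hy : y ∈ ⋃ x ∈ t, J x
    · rw [Set.indicator_of_mem hy]
      calc ∑ x ∈ t, (J x).indicator (fun _ => (1 : ℝ≥0∞)) y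
          = ((t.filter fun x => y ∈ J x).card : ℝ≥0∞) := by
            rw [Finset.card_filter]
            push_cast
            exact Finset.sum_congr rfl fun x _ => by simp [Set.indicator_apply]
        _ ≤ 2 := by exact_mod_cast ht y
    · rw [Set.indicator_of_notMem hy]
      refine (Finset.sum_eq_zero fun x hx => Set.indicator_of_notMem (fun h => hy ?_) _).le
      exact Set.mem_biUnion hx h
  have hx : ∀ x ∈ t, ν (J x) ≠ ∞ := fun x hx =>
    ne_top_of_le_ne_top hfin (measure_mono (Set.subset_biUnion_of_mem (u := J) hx))
  simp only [Measure.real]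
  rw [← ENNReal.toReal_sum hx]
  have := ENNReal.toReal_mono (ENNReal.mul_ne_top (by simp) hfin) key
  simpa using this

theorem sum_measureReal_inter_le_two_mul {ι : Type*} (t : Finset ι) (J : ι → Set ℝ)
    [∀ y, DecidablePred fun x => y ∈ J x]
    (hJ : ∀ x, MeasurableSet (J x)) (ht : ∀ y, (t.filter fun x => y ∈ J x).card ≤ 2)
    (ν : Measure ℝ) (hfin : ν (⋃ x ∈ t, J x) ≠ ∞) (B : Set ℝ) :
    ∑ x ∈ t, ν.real (J x ∩ B) ≤ 2 * ν.real ((⋃ x ∈ t, J x) ∩ B) := by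
  have := sum_measureReal_le_two_mul t J hJ ht (ν.restrict B)
    (ne_top_of_le_ne_top hfin (Measure.restrict_apply_le _ _))
  simpa only [measureReal_restrict_apply (hJ _),
    measureReal_restrict_apply (t.measurableSet_biUnion fun x _ => hJ x)] using this

theorem continuous_measureReal_Icc (μ : Measure ℝ) [IsLocallyFiniteMeasure μ]
    [NullSingletonClass μ] {f g : ℝ → ℝ} (hf : Continuous f) (hg : Continuous g)
    (hfg : ∀ r, f r ≤ g r) : Continuous fun r => μ.real (Set.Icc (f r) (g r)) := by
  have hint : ∀ a b, IntervalIntegrable (fun _ => (1 : ℝ)) μ a b := fun a b =>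
    intervalIntegrable_const
  have hc := intervalIntegral.continuous_primitive hint 0
  have : (fun r => μ.real (Set.Icc (f r) (g r))) =
      fun r => (∫ _ in (0 : ℝ)..(g r), (1 : ℝ) ∂μ) - ∫ _ in (0 : ℝ)..(f r), (1 : ℝ) ∂μ := by
    funext r
    rw [intervalIntegral.integral_interval_sub_left (hint _ _) (hint _ _),
      intervalIntegral.integral_of_le (hfg r)]
    simp [Measure.real, measure_congr (Ioc_ae_eq_Icc (μ := μ) (a := f r) (b := g r))]
  rw [this]
  exact (hc.comp hg).sub (hc.comp hf)

theorem exists_radius_measureReal_eq (μ ν : Measure ℝ) [IsLocallyFiniteMeasure μ]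
    [IsLocallyFiniteMeasure ν] [NullSingletonClass μ] [NullSingletonClass ν] (c : ℝ) {a b x r₀ : ℝ}
    (hx : x ∈ Set.Icc a b) (hr₀ : 0 < r₀)
    (h₀ : c * ν.real (Set.Icc (max a (x - r₀)) (min b (x + r₀)))
      ≤ μ.real (Set.Icc (max a (x - r₀)) (min b (x + r₀))))
    (h₁ : μ.real (Set.Icc a b) ≤ c * ν.real (Set.Icc a b)) :
    ∃ r > 0, μ.real (Set.Icc (max a (x - r)) (min b (x + r))) =
      c * ν.real (Set.Icc (max a (x - r)) (min b (x + r))) := by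
  set f : ℝ → ℝ := fun r => max a (x - |r|)
  set g : ℝ → ℝ := fun r => min b (x + |r|)
  have hf : Continuous f := by fun_prop
  have hg : Continuous g := by fun_prop
  have hfg : ∀ r, f r ≤ g r := fun r => by
    have := abs_nonneg r
    simp only [f, g, le_min_iff, max_le_iff]
    refine ⟨⟨hx.1.trans hx.2, ?_⟩, ?_, ?_⟩ <;> linarith [hx.1, hx.2]
  have hF : Continuous fun r => μ.real (Set.Icc (f r) (g r)) - c * ν.real (Set.Icc (f r) (g r)) :=
    (continuous_measureReal_Icc μ hf hg hfg).sub
      ((continuous_measureReal_Icc ν hf hg hfg).const_mul c)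
  have h01 : r₀ ≤ max r₀ (b - a) := le_max_left _ _
  have hr₁ : 0 < max r₀ (b - a) := hr₀.trans_le h01
  have h := intermediate_value_Icc' h01 hF.continuousOn
  have e0 : f r₀ = max a (x - r₀) ∧ g r₀ = min b (x + r₀) := by simp [f, g, abs_of_pos hr₀]
  have e1 : f (max r₀ (b - a)) = a ∧ g (max r₀ (b - a)) = b := by
    have := le_max_right r₀ (b - a)
    simp only [f, g, abs_of_pos hr₁]
    exact ⟨max_eq_left (by linarith [hx.2]), min_eq_left (by linarith [hx.1])⟩
  obtain ⟨r, hr, hr0⟩ := h (show (0 : ℝ) ∈ _ by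
    simp only [e0, e1]
    constructor <;> linarith)
  have hrp : 0 < r := hr₀.trans_le hr.1
  refine ⟨r, hrp, ?_⟩
  simp only [f, g, abs_of_pos hrp] at hr0
  linarith

theorem Icc_max_min_subset (a b x r : ℝ) :
    Set.Icc (max a (x - r)) (min b (x + r)) ⊆ Set.Icc a b :=
  Set.Icc_subset_Icc (le_max_left _ _) (min_le_left _ _)

theorem max_lt_min_of_mem_Icc {a b x r : ℝ} (hab : a < b) (hx : x ∈ Set.Icc a b) (hr : 0 < r) :
    max a (x - r) < min b (x + r) := by
  simp only [lt_min_iff, max_lt_iff]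
  refine ⟨⟨hab, ?_⟩, ?_, ?_⟩ <;> linarith [hx.1, hx.2]

theorem Icc_max_min_mem_nhdsWithin {a b x r : ℝ} {K : Set ℝ} (hK : K ⊆ Set.Icc a b)
    (hr : 0 < r) : Set.Icc (max a (x - r)) (min b (x + r)) ∈ 𝓝[K] x := by
  have h1 : Set.Icc (x - r) (x + r) ∈ 𝓝[K] x :=
    mem_nhdsWithin_of_mem_nhds (Icc_mem_nhds (by linarith) (by linarith))
  filter_upwards [h1, self_mem_nhdsWithin] with y hy hyK
  have := hK hyK
  simp only [Set.mem_Icc, le_min_iff, max_le_iff]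
  exact ⟨⟨this.1, hy.1⟩, this.2, hy.2⟩

theorem exists_radius_subset_open {U : Set ℝ} (hU : IsOpen U) {x : ℝ} (hx : x ∈ U) (a b : ℝ) :
    ∃ r > 0, Set.Icc (max a (x - r)) (min b (x + r)) ⊆ U := by
  obtain ⟨r, hr, h⟩ := Metric.nhds_basis_closedBall.mem_iff.1 (hU.mem_nhds hx)
  refine ⟨r, hr, fun y hy => h ?_⟩
  rw [Real.closedBall_eq_Icc]
  exact ⟨(le_max_right _ _).trans hy.1, hy.2.trans (min_le_right _ _)⟩

/-- Bounding a measure of a measurable set by bounding its compact subsets. -/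
theorem measureReal_le_of_forall_isCompact {ν : Measure ℝ} [ν.InnerRegularCompactLTTop] {S : Set ℝ}
    (hS : MeasurableSet S) (hfin : ν S ≠ ∞) {M : ℝ}
    (h : ∀ K ⊆ S, IsCompact K → ν.real K ≤ M) : ν.real S ≤ M := by
  by_contra! hlt
  have hM : 0 ≤ M := by simpa using h ∅ (Set.empty_subset _) isCompact_empty
  have h1 : ENNReal.ofReal M < ν S := (ENNReal.ofReal_lt_iff_lt_toReal hM hfin).2 hlt
  obtain ⟨K, hKS, hK, hlt'⟩ := hS.exists_lt_isCompact_of_ne_top hfin h1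
  have := (ENNReal.ofReal_lt_iff_lt_toReal hM
    (ne_top_of_le_ne_top hfin (measure_mono hKS))).1 hlt'
  exact absurd (h K hKS hK) (not_le.2 this)

theorem exists_isOpen_measureReal_lt {μ : Measure ℝ} [μ.OuterRegular] {F : Set ℝ} (hF : μ F ≠ ∞)
    {c : ℝ} (h : μ.real F < c) : ∃ U ⊇ F, IsOpen U ∧ μ U ≠ ∞ ∧ μ.real U < c := by
  have hc : 0 < c := measureReal_nonneg.trans_lt h
  obtain ⟨U, hFU, hU, hlt⟩ := F.exists_isOpen_lt_of_lt (ENNReal.ofReal c)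
    ((ENNReal.lt_ofReal_iff_toReal_lt hF).2 h)
  exact ⟨U, hFU, hU, hlt.ne_top, (ENNReal.lt_ofReal_iff_toReal_lt hlt.ne_top).1 hlt⟩

/-- A comparison of two measures on small portions of intervals at a single scale self-improves
to a power-type comparison. -/
theorem measureReal_le_pow_of_forall_Icc (μ ν : Measure ℝ) [IsLocallyFiniteMeasure μ]
    [IsLocallyFiniteMeasure ν] [NullSingletonClass μ] {γ θ : ℝ} (hγ : 0 < γ) (hγ1 : γ < 1)
    (hθ : 0 ≤ θ) (hθ1 : θ < 1)
    (H : ∀ a b F, a < b → MeasurableSet F → F ⊆ Set.Icc a b →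
      μ.real F ≤ γ * μ.real (Set.Icc a b) → ν.real F ≤ θ * ν.real (Set.Icc a b)) (k : ℕ) :
    ∀ a b F, a < b → MeasurableSet F → F ⊆ Set.Icc a b →
      μ.real F ≤ (γ / 4) ^ k * μ.real (Set.Icc a b) →
      ν.real F ≤ ((1 + θ) / 2) ^ k * ν.real (Set.Icc a b) := by
  induction k with
  | zero =>
    intro a b F _ _ hFI _
    simpa using measureReal_mono hFI isCompact_Icc.measure_lt_top.ne
  | succ k ih =>
    intro a b F hab hF hFI hμF
    have hIμ : μ (Set.Icc a b) ≠ ∞ := isCompact_Icc.measure_lt_top.ne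
    have hIν : ν (Set.Icc a b) ≠ ∞ := isCompact_Icc.measure_lt_top.ne
    have hfinμ : ∀ S ⊆ Set.Icc a b, μ S ≠ ∞ := fun S hS => ne_top_of_le_ne_top hIμ (measure_mono hS)
    have hfinν : ∀ S ⊆ Set.Icc a b, ν S ≠ ∞ := fun S hS => ne_top_of_le_ne_top hIν (measure_mono hS)
    rcases (measureReal_nonneg (μ := μ) (s := Set.Icc a b)).eq_or_lt with h0 | hpos
    · have h1 := H a b (Set.Icc a b) hab measurableSet_Icc subset_rfl (by rw [← h0]; simp)
      have h2 : ν.real (Set.Icc a b) = 0 := by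
        have := measureReal_nonneg (μ := ν) (s := Set.Icc a b)
        nlinarith
      rw [h2, mul_zero, ← h2]
      exact measureReal_mono hFI hIν
    have hlt : μ.real F < 2 * ((γ / 4) ^ (k + 1) * μ.real (Set.Icc a b)) := by
      have : 0 < (γ / 4) ^ (k + 1) * μ.real (Set.Icc a b) := by positivity
      linarith
    obtain ⟨U, hFU, hU, hUfin, hUlt⟩ := exists_isOpen_measureReal_lt (hfinμ F hFI) hlt
    refine (measureReal_mono (Set.subset_inter hFU hFI)
      (hfinν _ Set.inter_subset_right)).trans ?_
    refine measureReal_le_of_forall_isCompact (hU.measurableSet.inter measurableSet_Icc)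
      (hfinν _ Set.inter_subset_right) fun K hKS hK => ?_
    have hUI : μ.real (U ∩ Set.Icc a b) < 2 * ((γ / 4) ^ (k + 1) * μ.real (Set.Icc a b)) :=
      (measureReal_mono Set.inter_subset_left hUfin).trans_lt hUlt
    have hsel : ∀ x ∈ U ∩ Set.Icc a b, ∃ r > 0,
        (μ.restrict U).real (Set.Icc (max a (x - r)) (min b (x + r))) =
          γ * μ.real (Set.Icc (max a (x - r)) (min b (x + r))) := by
      intro x hx
      obtain ⟨r₀, hr₀, hr₀U⟩ := exists_radius_subset_open hU hx.1 a b
      refine exists_radius_measureReal_eq _ _ γ hx.2 hr₀ ?_ ?_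
      · rw [measureReal_restrict_apply measurableSet_Icc, Set.inter_eq_left.2 hr₀U]
        exact mul_le_of_le_one_left measureReal_nonneg hγ1.le
      · rw [measureReal_restrict_apply measurableSet_Icc, Set.inter_comm]
        refine hUI.le.trans ?_
        rw [← mul_assoc]
        refine mul_le_mul_of_nonneg_right ?_ hpos.le
        have : (γ / 4) ^ k ≤ 1 := pow_le_one₀ (by positivity) (by linarith)
        rw [pow_succ]
        nlinarith
    choose! r hr hreq using hsel
    set J : ℝ → Set ℝ := fun x => Set.Icc (max a (x - r x)) (min b (x + r x)) with hJ
    have hJm : ∀ x, MeasurableSet (J x) := fun x => measurableSet_Icc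
    obtain ⟨t, htK, hKt, ht⟩ := hK.exists_finset_cover_overlap_le_two
      (fun x => max a (x - r x)) (fun x => min b (x + r x))
      fun x hx => Icc_max_min_mem_nhdsWithin (hKS.trans Set.inter_subset_right) (hr x (hKS hx))
    set V := ⋃ x ∈ t, J x with hV
    have hVI : V ⊆ Set.Icc a b := Set.iUnion₂_subset fun x _ => Icc_max_min_subset _ _ _ _
    have hVm : MeasurableSet V := t.measurableSet_biUnion fun x _ => hJm x
    have hμU := sum_measureReal_inter_le_two_mul t J hJm ht μ (hfinμ _ hVI) U
    have hμJ : ∀ x ∈ t, μ.real (J x ∩ U) = γ * μ.real (J x) := fun x hx => by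
      rw [← measureReal_restrict_apply (hJm x)]
      exact hreq x (hKS (htK x hx))
    have hμV : μ.real V ≤ (γ / 4) ^ k * μ.real (Set.Icc a b) := by
      have h1 : μ.real V ≤ ∑ x ∈ t, μ.real (J x) := measureReal_biUnion_finset_le _ _
      rw [Finset.sum_congr rfl hμJ, ← Finset.mul_sum] at hμU
      have h2 : μ.real (V ∩ U) ≤ μ.real (U ∩ Set.Icc a b) :=
        measureReal_mono (fun y hy => ⟨hy.2, hVI hy.1⟩) (hfinμ _ Set.inter_subset_right)
      have h3 : γ * μ.real V ≤ γ * ((γ / 4) ^ k * μ.real (Set.Icc a b)) := by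
        rw [pow_succ] at hUI
        nlinarith
      exact le_of_mul_le_mul_left h3 hγ
    have hνV := ih a b V hab hVm hVI hμV
    have hνJ : ∀ x ∈ t, (1 - θ) * ν.real (J x) ≤ ν.real (J x ∩ Uᶜ) := fun x hx => by
      have hxS := hKS (htK x hx)
      have h1 := H _ _ (J x ∩ U) (max_lt_min_of_mem_Icc hab hxS.2 (hr x hxS))
        ((hJm x).inter hU.measurableSet) Set.inter_subset_left (hμJ x hx).le
      have h2 := measureReal_inter_add_sdiff (μ := ν) (s := J x) hU.measurableSet
        (hfinν _ (Icc_max_min_subset _ _ _ _))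
      rw [Set.sdiff_eq] at h2
      have h3 : ν.real (Set.Icc (max a (x - r x)) (min b (x + r x))) = ν.real (J x) := rfl
      rw [h3] at h1
      linarith
    have hνU := sum_measureReal_inter_le_two_mul t J hJm ht ν (hfinν _ hVI) Uᶜ
    have h1 : ν.real V ≤ ∑ x ∈ t, ν.real (J x) := measureReal_biUnion_finset_le _ _
    have h2 := Finset.sum_le_sum hνJ
    rw [← Finset.mul_sum] at h2
    have h3 := measureReal_inter_add_sdiff (μ := ν) (s := V) hU.measurableSet (hfinν _ hVI)
    rw [Set.sdiff_eq] at h3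
    have h4 : ν.real K ≤ ν.real (V ∩ U) :=
      measureReal_mono (fun y hy => ⟨hKt hy, (hKS hy).1⟩)
        (hfinν _ (Set.inter_subset_left.trans hVI))
    have h5 : (1 - θ) * ν.real V ≤ (1 - θ) * ∑ x ∈ t, ν.real (J x) :=
      mul_le_mul_of_nonneg_left h1 (by linarith)
    calc ν.real K ≤ (1 + θ) / 2 * ν.real V := by linarith
      _ ≤ (1 + θ) / 2 * (((1 + θ) / 2) ^ k * ν.real (Set.Icc a b)) :=
        mul_le_mul_of_nonneg_left hνV (by linarith)
      _ = _ := by ring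

/-- The one-dimensional weighted Tauberian estimate: if every point of `S` lies in an interval
which is mostly filled by `G`, then `S` has hardly larger measure than `G`. -/
theorem measure_le_of_forall_mem_Ioo (ν : Measure ℝ) [IsLocallyFiniteMeasure ν] {δ κ : ℝ}
    (hκ : 0 ≤ κ) (hκ1 : κ ≤ 1 / 4)
    (H : ∀ a b F, a < b → MeasurableSet F → F ⊆ Set.Icc a b →
      volume.real F ≤ δ * (b - a) → ν.real F ≤ κ * ν.real (Set.Icc a b))
    {S G : Set ℝ} (hS : MeasurableSet S) (hG : MeasurableSet G)
    (h : ∀ x ∈ S, ∃ p q : ℝ, x ∈ Set.Ioo p q ∧ volume.real (Set.Icc p q \ G) ≤ δ * (q - p)) :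
    ν S ≤ ENNReal.ofReal (1 + 4 * κ) * ν G := by
  rcases eq_or_ne (ν G) ∞ with hGt | hGt
  · rw [hGt, ENNReal.mul_top]
    · exact le_top
    · simp; linarith
  rw [hS.measure_eq_iSup_isCompact ν]
  refine iSup_le fun K => iSup_le fun hKS => iSup_le fun hK => ?_
  choose! p q hx hpq using h
  set J : ℝ → Set ℝ := fun x => Set.Icc (p x) (q x) with hJ
  have hJm : ∀ x, MeasurableSet (J x) := fun x => measurableSet_Icc
  obtain ⟨t, htK, hKt, ht⟩ := hK.exists_finset_cover_overlap_le_two p q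
    fun x hxK => mem_nhdsWithin_of_mem_nhds
      (Icc_mem_nhds (hx x (hKS hxK)).1 (hx x (hKS hxK)).2)
  set V := ⋃ x ∈ t, J x with hV
  have hVm : MeasurableSet V := t.measurableSet_biUnion fun x _ => hJm x
  have hVc : IsCompact V := t.isCompact_biUnion fun x _ => isCompact_Icc
  have hVf : ν V ≠ ∞ := hVc.measure_lt_top.ne
  have h1 : ∀ x ∈ t, ν.real (J x ∩ Gᶜ) ≤ κ * ν.real (J x) := fun x hxt => by
    have hxS := hKS (htK x hxt)
    exact H _ _ _ ((hx x hxS).1.trans (hx x hxS).2) ((hJm x).inter hG.compl)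
      Set.inter_subset_left (by rw [← Set.sdiff_eq]; exact hpq x hxS)
  have h2 := Finset.sum_le_sum h1
  rw [← Finset.mul_sum] at h2
  have h3 := sum_measureReal_le_two_mul t J hJm ht ν hVf
  have h4 : ν.real (V ∩ Gᶜ) ≤ ∑ x ∈ t, ν.real (J x ∩ Gᶜ) := by
    rw [hV, Set.iUnion₂_inter]
    exact measureReal_biUnion_finset_le _ _
  have h5 := measureReal_inter_add_sdiff (μ := ν) (s := V) hG hVf
  rw [Set.sdiff_eq] at h5
  have h6 : ν.real (V ∩ G) ≤ ν.real G := measureReal_mono Set.inter_subset_right hGt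
  have h7 : ν.real V ≤ (1 + 4 * κ) * ν.real G := by
    have h8 : (1 - 2 * κ) * ν.real V ≤ ν.real G := by
      have := mul_le_mul_of_nonneg_left h3 hκ
      linarith
    have h9 : 0 ≤ ν.real V := measureReal_nonneg
    have h10 : 1 ≤ (1 + 4 * κ) * (1 - 2 * κ) := by nlinarith
    nlinarith
  calc ν K ≤ ν V := measure_mono hKt
    _ = ENNReal.ofReal (ν.real V) := (ofReal_measureReal hVf).symm
    _ ≤ ENNReal.ofReal ((1 + 4 * κ) * ν.real G) := ENNReal.ofReal_le_ofReal h7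
    _ = _ := by rw [ENNReal.ofReal_mul (by linarith), ofReal_measureReal hGt]

theorem ofReal_le_maximalOne_indicator {v : ℝ → ℝ} (hv0 : ∀ x, 0 ≤ v x) {I : Set ℝ} {p q x lam : ℝ}
    (hpq : p < q) (hx : x ∈ Set.Icc p q) (hI : Set.Icc p q ⊆ I)
    (h : ENNReal.ofReal (lam * (q - p)) ≤
      (volume.withDensity fun x => ENNReal.ofReal (v x)) (Set.Icc p q)) :
    ENNReal.ofReal lam ≤ maximalOne (I.indicator v) x := by
  refine le_trans ?_ (le_iSup₂_of_le p q (le_iSup₂_of_le hpq hx le_rfl))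
  have h1 : ∫⁻ y in Set.Icc p q, ‖I.indicator v y‖ₑ =
      (volume.withDensity fun x => ENNReal.ofReal (v x)) (Set.Icc p q) := by
    rw [withDensity_apply _ measurableSet_Icc]
    refine setLIntegral_congr_fun measurableSet_Icc fun y hy => ?_
    simp only [Set.indicator_of_mem (hI hy), Real.enorm_of_nonneg (hv0 y)]
  have hd : 0 < q - p := by linarith
  rw [h1, Real.volume_Icc, ENNReal.le_div_iff_mul_le (by simp [hpq]) (by simp)]
  rwa [← ENNReal.ofReal_mul' hd.le]

theorem sum_two_pow_indicator_le (N : ℕ) (V : ℕ → Set ℝ) (L m : ℝ≥0∞) (x : ℝ)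
    (h : ∀ k < N, x ∈ V k → 2 ^ k * L ≤ m) :
    ∑ k ∈ Finset.range N, (V k).indicator (fun _ => 2 ^ k * L) x ≤ 2 * m := by
  have hsum : ∀ n : ℕ, ∑ k ∈ Finset.range n, (2 : ℝ≥0∞) ^ k * L ≤ 2 ^ n * L := by
    intro n
    induction n with
    | zero => simp
    | succ n ih =>
      rw [Finset.sum_range_succ, pow_succ, mul_two, add_mul]
      gcongr
  induction N with
  | zero => simp
  | succ N ih =>
    by_cases hx : x ∈ V N
    · calc _ ≤ ∑ k ∈ Finset.range (N + 1), (2 : ℝ≥0∞) ^ k * L :=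
            Finset.sum_le_sum fun k _ => Set.indicator_le_self (V k) (fun _ => 2 ^ k * L) x
        _ ≤ 2 ^ (N + 1) * L := hsum _
        _ = 2 * (2 ^ N * L) := by ring
        _ ≤ 2 * m := by gcongr; exact h N (Nat.lt_succ_self N) hx
    · rw [Finset.sum_range_succ, Set.indicator_of_notMem hx, add_zero]
      exact ih fun k hk => h k (hk.trans (Nat.lt_succ_self N))

/-- A reverse weak-type bound: the level set of the maximal function at height `lam` is large. -/
theorem exists_subset_maximalOne_ge {v : ℝ → ℝ} (hv0 : ∀ x, 0 ≤ v x)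
    (ν : Measure ℝ) (hν : ν = volume.withDensity fun x => ENNReal.ofReal (v x))
    [IsLocallyFiniteMeasure ν] {a b lam : ℝ} (hab : a < b) (hlam : 0 ≤ lam)
    {U : Set ℝ} (hU : IsOpen U) (hlt : ν.real (U ∩ Set.Icc a b) ≤ lam * (b - a))
    {K : Set ℝ} (hK : IsCompact K) (hKU : K ⊆ U ∩ Set.Icc a b) :
    ∃ V, MeasurableSet V ∧ V ⊆ Set.Icc a b ∧
      (∀ x ∈ V, ENNReal.ofReal lam ≤ maximalOne ((Set.Icc a b).indicator v) x) ∧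
      ν.real K ≤ 2 * lam * volume.real V + 2 * lam * volume.real (U ∩ Set.Icc a b) := by
  classical
  have : NullSingletonClass ν := by rw [hν]; infer_instance
  have hIν : ν (Set.Icc a b) ≠ ∞ := isCompact_Icc.measure_lt_top.ne
  have hIvol : volume (Set.Icc a b) ≠ ∞ := isCompact_Icc.measure_lt_top.ne
  have hfinν : ∀ S ⊆ Set.Icc a b, ν S ≠ ∞ := fun S hS => ne_top_of_le_ne_top hIν (measure_mono hS)
  have hfin : ∀ S ⊆ Set.Icc a b, volume S ≠ ∞ := fun S hS =>
    ne_top_of_le_ne_top hIvol (measure_mono hS)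
  have hsel : ∀ x ∈ U ∩ Set.Icc a b, ∃ r > 0,
      (ν.restrict U).real (Set.Icc (max a (x - r)) (min b (x + r))) ≤
        lam * volume.real (Set.Icc (max a (x - r)) (min b (x + r))) ∧
      (Set.Icc (max a (x - r)) (min b (x + r)) ⊆ U ∨
      (ν.restrict U).real (Set.Icc (max a (x - r)) (min b (x + r))) =
        lam * volume.real (Set.Icc (max a (x - r)) (min b (x + r)))) := by
    intro x hx
    by_cases hex : ∃ r₀ > 0, lam * volume.real (Set.Icc (max a (x - r₀)) (min b (x + r₀))) ≤
      (ν.restrict U).real (Set.Icc (max a (x - r₀)) (min b (x + r₀)))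
    · obtain ⟨r₀, hr₀, h₀⟩ := hex
      obtain ⟨r, hr, hreq⟩ := exists_radius_measureReal_eq _ _ lam hx.2 hr₀ h₀ (by
        rwa [measureReal_restrict_apply measurableSet_Icc, Set.inter_comm,
          Real.volume_real_Icc_of_le hab.le])
      exact ⟨r, hr, hreq.le, Or.inr hreq⟩
    · push Not at hex
      obtain ⟨r, hr, hrU⟩ := exists_radius_subset_open hU hx.1 a b
      exact ⟨r, hr, (hex r hr).le, Or.inl hrU⟩
  choose! r hr hrle hror using hsel
  set J : ℝ → Set ℝ := fun x => Set.Icc (max a (x - r x)) (min b (x + r x)) with hJ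
  have hJm : ∀ x, MeasurableSet (J x) := fun x => measurableSet_Icc
  have hJI : ∀ x, J x ⊆ Set.Icc a b := fun x => Icc_max_min_subset _ _ _ _
  obtain ⟨t, htK, hKt, ht⟩ := hK.exists_finset_cover_overlap_le_two
    (fun x => max a (x - r x)) (fun x => min b (x + r x))
    fun x hx => Icc_max_min_mem_nhdsWithin (hKU.trans Set.inter_subset_right) (hr x (hKU hx))
  have hsub : ∀ P : ℝ → Prop, ∀ y, ((t.filter P).filter fun x => y ∈ J x).card ≤ 2 := fun P y =>
    (Finset.card_le_card (Finset.filter_subset_filter _ (Finset.filter_subset _ _))).trans (ht y)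
  have hUI : ∀ s : Finset ℝ, (⋃ x ∈ s, J x) ⊆ Set.Icc a b := fun s =>
    Set.iUnion₂_subset fun x _ => hJI x
  have hA := sum_measureReal_le_two_mul _ J hJm (hsub fun x => ¬ J x ⊆ U) volume (hfin _ (hUI _))
  have hB := sum_measureReal_le_two_mul _ J hJm (hsub fun x => J x ⊆ U) volume (hfin _ (hUI _))
  refine ⟨⋃ x ∈ t.filter (fun x => ¬ J x ⊆ U), J x,
    Finset.measurableSet_biUnion _ fun x _ => hJm x, hUI _, ?_, ?_⟩
  · intro y hy
    simp only [Set.mem_iUnion, Finset.mem_filter, exists_prop] at hy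
    obtain ⟨x, ⟨hxt, hxU⟩, hyx⟩ := hy
    have hxS := hKU (htK x hxt)
    have hl := max_lt_min_of_mem_Icc hab hxS.2 (hr x hxS)
    refine ofReal_le_maximalOne_indicator hv0 hl hyx (hJI x) ?_
    rw [← hν, ← Real.volume_real_Icc_of_le hl.le, ← (hror x hxS).resolve_left hxU,
      measureReal_restrict_apply measurableSet_Icc]
    exact ENNReal.ofReal_le_of_le_toReal
      (measureReal_mono Set.inter_subset_left (hfinν _ (hJI x)))
  · have h1 : ν.real K ≤ ∑ x ∈ t, (ν.restrict U).real (J x) := by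
      have : ν.real K ≤ ν.real (⋃ x ∈ t, J x ∩ U) := by
        refine measureReal_mono (fun y hy => ?_) (hfinν _ (Set.iUnion₂_subset fun x _ =>
          Set.inter_subset_left.trans (hJI x)))
        obtain ⟨x, hx, hy'⟩ := Set.mem_iUnion₂.1 (hKt hy)
        exact Set.mem_iUnion₂.2 ⟨x, hx, hy', (hKU hy).1⟩
      refine this.trans ((measureReal_biUnion_finset_le _ _).trans (Finset.sum_le_sum fun x _ => ?_))
      rw [measureReal_restrict_apply (hJm x)]
    have h2 : ∑ x ∈ t, (ν.restrict U).real (J x) ≤ lam * ∑ x ∈ t, volume.real (J x) := by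
      rw [Finset.mul_sum]
      exact Finset.sum_le_sum fun x hx => hrle x (hKU (htK x hx))
    rw [← Finset.sum_filter_add_sum_filter_not t (fun x => J x ⊆ U)
      (fun x => volume.real (J x))] at h2
    have h3 : volume.real (⋃ x ∈ t.filter (fun x => J x ⊆ U), J x) ≤
        volume.real (U ∩ Set.Icc a b) := by
      refine measureReal_mono (Set.iUnion₂_subset fun x hx => ?_) (hfin _ Set.inter_subset_right)
      exact Set.subset_inter (Finset.mem_filter.1 hx).2 (hJI x)
    have h4 := add_le_add (hB.trans (mul_le_mul_of_nonneg_left h3 zero_le_two)) hA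
    have h5 := mul_le_mul_of_nonneg_left h4 hlam
    refine h1.trans (h2.trans (le_trans (le_of_eq ?_) (h5.trans (le_of_eq ?_))))
    · congr!
    · ring_nf
      congr!

theorem lintegral_maximalOne_le {v : ℝ → ℝ} {A : ℝ} (hA : aInftyConst v ≤ ENNReal.ofReal A)
    (ν : Measure ℝ) (hν : ν = volume.withDensity fun x => ENNReal.ofReal (v x))
    [IsLocallyFiniteMeasure ν] {a b : ℝ} (hab : a < b) (h0 : ν (Set.Icc a b) ≠ 0) :
    ∫⁻ x in Set.Icc a b, maximalOne ((Set.Icc a b).indicator v) x ≤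
      ENNReal.ofReal A * ν (Set.Icc a b) := by
  have h1 : (∫⁻ x in Set.Icc a b, maximalOne ((Set.Icc a b).indicator v) x) /
      ν (Set.Icc a b) ≤ ENNReal.ofReal A := by
    rw [hν, withDensity_apply _ measurableSet_Icc]
    refine le_trans ?_ hA
    unfold aInftyConst
    exact le_iSup_of_le a (le_iSup_of_le b (le_iSup_of_le hab le_rfl))
  exact (ENNReal.div_le_iff h0 isCompact_Icc.measure_lt_top.ne).1 h1

/-- Sets of small relative length carry at most half the mass of an interval. -/
theorem measureReal_le_half_of_aInftyConst_le {v : ℝ → ℝ} (hv0 : ∀ x, 0 ≤ v x) {A : ℝ}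
    (hA0 : 0 < A) (hA : aInftyConst v ≤ ENNReal.ofReal A) (ν : Measure ℝ)
    (hν : ν = volume.withDensity fun x => ENNReal.ofReal (v x))
    [IsLocallyFiniteMeasure ν] {N : ℕ} (hN : 32 * A ≤ N) (a b : ℝ) (F : Set ℝ) (hab : a < b)
    (hFI : F ⊆ Set.Icc a b)
    (hF : volume.real F ≤ (1 / 2) ^ (N + 5) * volume.real (Set.Icc a b)) :
    ν.real F ≤ 1 / 2 * ν.real (Set.Icc a b) := by
  have hIν : ν (Set.Icc a b) ≠ ∞ := isCompact_Icc.measure_lt_top.ne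
  have hIvol : volume (Set.Icc a b) ≠ ∞ := isCompact_Icc.measure_lt_top.ne
  have hfinν : ∀ S ⊆ Set.Icc a b, ν S ≠ ∞ := fun S hS => ne_top_of_le_ne_top hIν (measure_mono hS)
  have hfin : ∀ S ⊆ Set.Icc a b, volume S ≠ ∞ := fun S hS =>
    ne_top_of_le_ne_top hIvol (measure_mono hS)
  have hl : 0 < b - a := by linarith
  rw [Real.volume_real_Icc_of_le hab.le] at hF
  obtain ⟨U, hFU, hU, hUfin, hUlt⟩ := exists_isOpen_measureReal_lt (hfin F hFI)
    (show volume.real F < 2 * ((1 / 2) ^ (N + 5) * (b - a)) by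
      have : 0 < (1 / 2 : ℝ) ^ (N + 5) * (b - a) := by positivity
      linarith)
  have hUI : volume.real (U ∩ Set.Icc a b) ≤ 2 * ((1 / 2) ^ (N + 5) * (b - a)) :=
    (measureReal_mono Set.inter_subset_left hUfin).trans hUlt.le
  refine (measureReal_mono (Set.subset_inter hFU hFI) (hfinν _ Set.inter_subset_right)).trans ?_
  set m := ν.real (U ∩ Set.Icc a b) with hm
  have hm0 : 0 ≤ m := measureReal_nonneg
  rcases hm0.eq_or_lt with hm0 | hmpos
  · rw [← hm0]; positivity
  have hνI : m ≤ ν.real (Set.Icc a b) := measureReal_mono Set.inter_subset_right hIν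
  have hνI0 : ν (Set.Icc a b) ≠ 0 := fun h => by
    rw [Measure.real, h, ENNReal.toReal_zero] at hνI
    linarith
  obtain ⟨K, hKS, hK, hKm⟩ : ∃ K ⊆ U ∩ Set.Icc a b, IsCompact K ∧ m / 2 < ν.real K := by
    by_contra! h
    have := measureReal_le_of_forall_isCompact (ν := ν) (hU.measurableSet.inter measurableSet_Icc)
      (hfinν _ Set.inter_subset_right) h
    linarith
  set L := 2 * m / (b - a) with hL
  have hLpos : 0 < L := by positivity
  have hLl : L * (b - a) = 2 * m := by rw [hL]; field_simp
  have hV : ∀ k : ℕ, ∃ V, MeasurableSet V ∧ V ⊆ Set.Icc a b ∧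
      (∀ x ∈ V, ENNReal.ofReal (2 ^ k * L) ≤ maximalOne ((Set.Icc a b).indicator v) x) ∧
      ν.real K ≤ 2 * (2 ^ k * L) * volume.real V
        + 2 * (2 ^ k * L) * volume.real (U ∩ Set.Icc a b) := fun k => by
    refine exists_subset_maximalOne_ge hv0 ν hν hab (by positivity) hU ?_ hK hKS
    have : (1 : ℝ) ≤ 2 ^ k := one_le_pow₀ (by norm_num)
    rw [mul_assoc, hLl, ← hm]
    nlinarith
  choose V hVm hVI hVM hVK using hV
  have hVlow : ∀ k ∈ Finset.range N, m / 8 ≤ 2 ^ k * L * volume.real (V k) := fun k hk => by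
    have hkN : k < N := Finset.mem_range.1 hk
    have h1 : 2 * (2 ^ k * L) * volume.real (U ∩ Set.Icc a b) ≤ m / 4 := by
      calc 2 * (2 ^ k * L) * volume.real (U ∩ Set.Icc a b)
          ≤ 2 * (2 ^ N * L) * (2 * ((1 / 2) ^ (N + 5) * (b - a))) := by
            gcongr
            norm_num
        _ = 4 * (2 ^ N * (1 / 2) ^ N) * (1 / 32) * (L * (b - a)) := by ring
        _ = m / 4 := by
            rw [← mul_pow, hLl]
            norm_num
            ring
    have := hVK k
    linarith
  have hsum : (N : ℝ) * (m / 8) ≤ 2 * (A * ν.real (Set.Icc a b)) := by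
    have h1 : ∑ k ∈ Finset.range N, (2 ^ k * ENNReal.ofReal L) * volume (V k) ≤
        2 * (ENNReal.ofReal A * ν (Set.Icc a b)) := by
      calc ∑ k ∈ Finset.range N, (2 ^ k * ENNReal.ofReal L) * volume (V k)
          = ∫⁻ x in Set.Icc a b, ∑ k ∈ Finset.range N,
              (V k).indicator (fun _ => 2 ^ k * ENNReal.ofReal L) x := by
            rw [lintegral_finsetSum' _ fun k _ =>
              (measurable_const.indicator (hVm k)).aemeasurable]
            refine Finset.sum_congr rfl fun k _ => ?_
            rw [lintegral_indicator_const (hVm k), Measure.restrict_apply (hVm k),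
              Set.inter_eq_left.2 (hVI k)]
        _ ≤ ∫⁻ x in Set.Icc a b, 2 * maximalOne ((Set.Icc a b).indicator v) x := by
            refine lintegral_mono fun x => sum_two_pow_indicator_le N V _ _ x fun k _ hx => ?_
            have := hVM k x hx
            rwa [ENNReal.ofReal_mul (by positivity), ENNReal.ofReal_pow (by norm_num),
              ENNReal.ofReal_ofNat] at this
        _ = 2 * ∫⁻ x in Set.Icc a b, maximalOne ((Set.Icc a b).indicator v) x :=
            lintegral_const_mul' _ _ (by simp)
        _ ≤ _ := by gcongr; exact lintegral_maximalOne_le hA ν hν hab hνI0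
    have h2 := ENNReal.toReal_mono (by finiteness) h1
    rw [ENNReal.toReal_sum fun k _ => by have := hfin _ (hVI k); finiteness] at h2
    simp only [ENNReal.toReal_mul, ENNReal.toReal_pow, ENNReal.toReal_ofNat,
      ENNReal.toReal_ofReal hLpos.le, ENNReal.toReal_ofReal hA0.le] at h2
    refine le_trans ?_ h2
    have := Finset.card_nsmul_le_sum _ _ _ hVlow
    rwa [Finset.card_range, nsmul_eq_mul] at this
  have h3 : 0 ≤ ν.real (Set.Icc a b) := measureReal_nonneg
  have h4 : 32 * A * (m / 8) ≤ N * (m / 8) := by gcongr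
  have h5 : 4 * A * m ≤ 4 * A * (1 / 2 * ν.real (Set.Icc a b)) := by linarith
  exact le_of_mul_le_mul_left h5 (by positivity)

/-- Under a doubling-type comparison, a measure vanishing on one interval vanishes on all. -/
theorem measureReal_Icc_eq_zero_of_half {ν : Measure ℝ} [IsLocallyFiniteMeasure ν] {γ : ℝ}
    (hγ : 0 < γ)
    (H : ∀ a b F, a < b → MeasurableSet F → F ⊆ Set.Icc a b →
      volume.real F ≤ γ * volume.real (Set.Icc a b) → ν.real F ≤ 1 / 2 * ν.real (Set.Icc a b))
    {a b : ℝ} (hab : a < b) (h0 : ν.real (Set.Icc a b) = 0) (c d : ℝ) :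
    ν.real (Set.Icc c d) = 0 := by
  set τ := γ * (b - a) / 2 with hτ
  have hl : 0 < b - a := by linarith
  have hτ0 : 0 < τ := by positivity
  have key : ∀ k : ℕ, ν.real (Set.Icc (a - k * τ) (b + k * τ)) = 0 := by
    intro k
    induction k with
    | zero => simpa using h0
    | succ k ih =>
      set I := Set.Icc (a - k * τ) (b + k * τ)
      have hk : (0 : ℝ) ≤ k * τ := by positivity
      have hk1 : ((k + 1 : ℕ) : ℝ) * τ = k * τ + τ := by push_cast; ring
      rw [hk1]
      set I' := Set.Icc (a - (k * τ + τ)) (b + (k * τ + τ))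
      have hsub : I ⊆ I' := Set.Icc_subset_Icc (by linarith) (by linarith)
      have hvol := measureReal_inter_add_sdiff (μ := volume) (s := I') (t := I) measurableSet_Icc
        isCompact_Icc.measure_lt_top.ne
      have hν := measureReal_inter_add_sdiff (μ := ν) (s := I') (t := I) measurableSet_Icc
        isCompact_Icc.measure_lt_top.ne
      rw [Set.inter_eq_right.2 hsub] at hvol hν
      have h1 : volume.real I = b - a + 2 * (k * τ) := by
        rw [Real.volume_real_Icc_of_le (by linarith)]; ring
      have h2 : volume.real I' = b - a + 2 * (k * τ + τ) := by
        rw [Real.volume_real_Icc_of_le (by linarith)]; ring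
      have h3 := H _ _ (I' \ I) (by linarith) (measurableSet_Icc.diff measurableSet_Icc)
        Set.sdiff_subset (by
          rw [h2]
          have : γ * (b - a) ≤ γ * (b - a + 2 * (k * τ + τ)) := by
            gcongr
            linarith
          linarith)
      have h4 : 0 ≤ ν.real I' := measureReal_nonneg
      have h5 : ν.real (Set.Icc (a - (k * τ + τ)) (b + (k * τ + τ))) = ν.real I' := rfl
      linarith
  obtain ⟨k, hk⟩ := exists_nat_ge (max ((a - c) / τ) ((d - b) / τ))
  have h1 := (div_le_iff₀ hτ0).1 ((le_max_left _ _).trans hk)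
  have h2 := (div_le_iff₀ hτ0).1 ((le_max_right _ _).trans hk)
  refine le_antisymm ?_ measureReal_nonneg
  rw [← key k]
  exact measureReal_mono (Set.Icc_subset_Icc (by linarith) (by linarith))
    isCompact_Icc.measure_lt_top.ne

theorem pow_mul_measureReal_le_of_half {ν : Measure ℝ} [IsLocallyFiniteMeasure ν]
    [NullSingletonClass ν] {γ : ℝ} (hγ : 0 < γ) (hγ1 : γ < 1)
    (H : ∀ a b F, a < b → MeasurableSet F → F ⊆ Set.Icc a b →
      volume.real F ≤ γ * volume.real (Set.Icc a b) → ν.real F ≤ 1 / 2 * ν.real (Set.Icc a b))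
    (k : ℕ) {a b : ℝ} {F : Set ℝ} (hab : a < b) (hF : MeasurableSet F) (hFI : F ⊆ Set.Icc a b)
    (h : (1 - γ / 2) ^ k * volume.real (Set.Icc a b) < volume.real F) :
    (1 / 16) ^ k * ν.real (Set.Icc a b) ≤ ν.real F := by
  by_cases hpos : ∀ c d : ℝ, c < d → 0 < ν.real (Set.Icc c d)
  · by_contra! hlt
    have H' : ∀ a b F, a < b → MeasurableSet F → F ⊆ Set.Icc a b →
        ν.real F ≤ 1 / 4 * ν.real (Set.Icc a b) →
        volume.real F ≤ (1 - γ) * volume.real (Set.Icc a b) := by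
      intro a b F hab hF hFI hle
      by_contra! hlt
      have h1 := measureReal_inter_add_sdiff (μ := volume) (s := Set.Icc a b) hF
        isCompact_Icc.measure_lt_top.ne
      have h2 := measureReal_inter_add_sdiff (μ := ν) (s := Set.Icc a b) hF
        isCompact_Icc.measure_lt_top.ne
      rw [Set.inter_eq_right.2 hFI] at h1 h2
      have h3 := H a b (Set.Icc a b \ F) hab (measurableSet_Icc.diff hF) Set.sdiff_subset
        (by linarith)
      have := hpos a b hab
      linarith
    have h1 := measureReal_le_pow_of_forall_Icc ν volume (by norm_num) (by norm_num)
      (by linarith) (by linarith) H' k a b F hab hF hFI (by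
        norm_num at hlt ⊢
        exact hlt.le)
    rw [show (1 + (1 - γ)) / 2 = 1 - γ / 2 by ring] at h1
    linarith
  · push Not at hpos
    obtain ⟨c, d, hcd, hle⟩ := hpos
    rw [measureReal_Icc_eq_zero_of_half hγ H hcd (le_antisymm hle measureReal_nonneg) a b, mul_zero]
    exact measureReal_nonneg

/-- Quantitative absolute continuity, in both directions, of a weight on the line whose
Fujii–Wilson constant is bounded by `A`. -/
theorem exists_power_comparison {A : ℝ} (hA0 : 0 < A) : ∃ γ : ℝ, 0 < γ ∧ γ < 1 ∧
    ∀ v : ℝ → ℝ, (∀ x, 0 ≤ v x) → aInftyConst v ≤ ENNReal.ofReal A →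
    ∀ ν : Measure ℝ, (ν = volume.withDensity fun x => ENNReal.ofReal (v x)) →
    IsLocallyFiniteMeasure ν → ∀ k a b F, a < b → MeasurableSet F → F ⊆ Set.Icc a b →
      (volume.real F ≤ (γ / 4) ^ k * (b - a) → ν.real F ≤ (3 / 4) ^ k * ν.real (Set.Icc a b)) ∧
      ((1 - γ / 2) ^ k * (b - a) < volume.real F →
        (1 / 16) ^ k * ν.real (Set.Icc a b) ≤ ν.real F) := by
  obtain ⟨N, hN⟩ := exists_nat_ge (32 * A)
  have hγ1 : (1 / 2 : ℝ) ^ (N + 5) < 1 := pow_lt_one₀ (by norm_num) (by norm_num) (by omega)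
  refine ⟨(1 / 2) ^ (N + 5), by positivity, hγ1, ?_⟩
  intro v hv0 hvA ν hν hloc k a b F hab hF hFI
  have : NullSingletonClass ν := by rw [hν]; infer_instance
  have H : ∀ a b F, a < b → MeasurableSet F → F ⊆ Set.Icc a b →
      volume.real F ≤ (1 / 2) ^ (N + 5) * volume.real (Set.Icc a b) →
      ν.real F ≤ 1 / 2 * ν.real (Set.Icc a b) := fun a b F hab _ hFI hF =>
    measureReal_le_half_of_aInftyConst_le hv0 hA0 hvA ν hν hN a b F hab hFI hF
  rw [← Real.volume_real_Icc_of_le hab.le]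
  constructor
  · intro h
    have := measureReal_le_pow_of_forall_Icc volume ν (by positivity) hγ1 (by norm_num)
      (by norm_num) H k a b F hab hF hFI h
    norm_num at this ⊢
    exact this
  · exact pow_mul_measureReal_le_of_half (by positivity) hγ1 H k hab hF hFI

/-- The point of `ℝⁿ` with `j`-th coordinate `t` and the other coordinates given by `y`. -/
def insertCoord {n : ℕ} (j : Fin n) (y : {i : Fin n // i ≠ j} → ℝ) (t : ℝ) : Fin n → ℝ :=
  fun i => if h : i = j then t else y ⟨i, h⟩

theorem insertCoord_same {n : ℕ} (j : Fin n) (y : {i : Fin n // i ≠ j} → ℝ) (t : ℝ) :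
    insertCoord j y t j = t := by
  simp [insertCoord]

theorem insertCoord_ne {n : ℕ} {i j : Fin n} (h : i ≠ j) (y : {i : Fin n // i ≠ j} → ℝ) (t : ℝ) :
    insertCoord j y t i = y ⟨i, h⟩ := by
  simp [insertCoord, h]

theorem update_insertCoord {n : ℕ} (j : Fin n) (y : {i : Fin n // i ≠ j} → ℝ) (t s : ℝ) :
    Function.update (insertCoord j y t) j s = insertCoord j y s := by
  ext i
  by_cases h : i = j
  · subst h; simp [insertCoord]
  · simp [insertCoord, h]

theorem measurePreserving_funUnique_symm (ι : Type*) [Unique ι] [inst : Fintype ι] :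
    MeasurePreserving (MeasurableEquiv.funUnique ι ℝ).symm volume (Measure.pi fun _ => volume) := by
  obtain rfl : inst = Unique.fintype := Subsingleton.elim _ _
  exact (volume_preserving_funUnique ι ℝ).symm

theorem measurePreserving_insertCoord {n : ℕ} (j : Fin n) :
    MeasurePreserving (fun p : ({i : Fin n // i ≠ j} → ℝ) × ℝ => insertCoord j p.1 p.2)
      (volume.prod volume) volume := by
  let u : Unique {i : Fin n // ¬ i ≠ j} :=
    { default := ⟨j, by simp⟩, uniq := fun i => Subtype.ext (not_not.1 i.2) }
  have h1 : MeasurePreserving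
      (MeasurableEquiv.piEquivPiSubtypeProd (fun _ : Fin n => ℝ) (fun i => i ≠ j)).symm
      (volume.prod volume) volume :=
    (volume_preserving_piEquivPiSubtypeProd (fun _ : Fin n => ℝ) (fun i => i ≠ j)).symm
  have h2 : MeasurePreserving (MeasurableEquiv.funUnique {i : Fin n // ¬ i ≠ j} ℝ).symm volume
      (Measure.pi fun _ => volume) := by
    exact measurePreserving_funUnique_symm _
  have h3 := (MeasurePreserving.id (volume : Measure ({i : Fin n // i ≠ j} → ℝ))).prod h2
  have h4 := h1.comp h3
  convert h4 using 1
  ext p i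
  by_cases h : i = j
  · subst h
    simp [insertCoord, MeasurableEquiv.piEquivPiSubtypeProd, Equiv.piEquivPiSubtypeProd,
      MeasurableEquiv.funUnique]
  · simp [insertCoord, h, MeasurableEquiv.piEquivPiSubtypeProd, Equiv.piEquivPiSubtypeProd]

theorem measurable_insertCoord {n : ℕ} (j : Fin n) (y : {i : Fin n // i ≠ j} → ℝ) :
    Measurable (insertCoord j y) :=
  (measurePreserving_insertCoord j).measurable.comp measurable_prodMk_left

theorem lintegral_eq_lintegral_insertCoord {n : ℕ} (j : Fin n) {f : (Fin n → ℝ) → ℝ≥0∞}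
    (hf : Measurable f) :
    ∫⁻ x, f x = ∫⁻ y : {i : Fin n // i ≠ j} → ℝ, ∫⁻ t : ℝ, f (insertCoord j y t) := by
  rw [← (measurePreserving_insertCoord j).lintegral_comp hf]
  exact lintegral_prod _ (hf.comp (measurePreserving_insertCoord j).measurable).aemeasurable

/-- The one-dimensional measure carried by a line parallel to the `j`-th axis. -/
noncomputable def sliceMeasure {n : ℕ} (w : (Fin n → ℝ) → ℝ) (j : Fin n)
    (y : {i : Fin n // i ≠ j} → ℝ) : Measure ℝ :=
  volume.withDensity fun t => ENNReal.ofReal (slice w j y t)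

theorem weightMeasure_eq_lintegral_sliceMeasure {n : ℕ} {w : (Fin n → ℝ) → ℝ} (hw : Measurable w)
    (j : Fin n) {S : Set (Fin n → ℝ)} (hS : MeasurableSet S) :
    weightMeasure w S = ∫⁻ y, sliceMeasure w j y {t | insertCoord j y t ∈ S} := by
  have hm : Measurable fun x => ENNReal.ofReal (w x) := hw.ennreal_ofReal
  rw [weightMeasure, withDensity_apply _ hS, ← lintegral_indicator hS,
    lintegral_eq_lintegral_insertCoord j (hm.indicator hS)]
  refine lintegral_congr fun y => ?_
  have hSy : MeasurableSet {t | insertCoord j y t ∈ S} := measurable_insertCoord j y hS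
  rw [sliceMeasure, withDensity_apply _ hSy, ← lintegral_indicator hSy]
  rfl

theorem measurableSet_section_update {n : ℕ} (j : Fin n) {S : Set (Fin n → ℝ)}
    (hS : MeasurableSet S) : MeasurableSet {p : (Fin n → ℝ) × ℝ | Function.update p.1 j p.2 ∈ S} :=
  measurable_update' hS

/-- The points lying in an interval parallel to the `j`-th axis of which `G` covers all but a
proportion `δ`. -/
def lineFill {n : ℕ} (j : Fin n) (δ : ℝ) (G : Set (Fin n → ℝ)) : Set (Fin n → ℝ) :=
  {x | ∃ p q : ℚ, x j ∈ Set.Ioo (p : ℝ) q ∧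
    volume.real (Set.Icc (p : ℝ) q \ {t | Function.update x j t ∈ G}) ≤ δ * (q - p)}

theorem measurableSet_lineFill {n : ℕ} (j : Fin n) (δ : ℝ) {G : Set (Fin n → ℝ)}
    (hG : MeasurableSet G) : MeasurableSet (lineFill j δ G) := by
  simp only [lineFill, Set.ofPred_exists]
  refine MeasurableSet.iUnion fun p => MeasurableSet.iUnion fun q => ?_
  refine (measurableSet_Ioo.preimage (measurable_pi_apply j)).inter ?_
  have h := measurable_measure_prodMk_left (ν := (volume : Measure ℝ))
    ((measurable_snd measurableSet_Icc).diff (measurableSet_section_update j hG) :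
      MeasurableSet ((Prod.snd ⁻¹' Set.Icc (p : ℝ) q) \
        {p : (Fin n → ℝ) × ℝ | Function.update p.1 j p.2 ∈ G}))
  exact measurableSet_le h.ennreal_toReal measurable_const

theorem weightMeasure_lineFill_le {n : ℕ} {w : (Fin n → ℝ) → ℝ} (hw : Measurable w) {j : Fin n}
    {δ κ : ℝ} (hκ : 0 ≤ κ) (hκ1 : κ ≤ 1 / 4)
    (H : ∀ᵐ y, IsLocallyFiniteMeasure (sliceMeasure w j y) ∧ ∀ a b F, a < b → MeasurableSet F →
      F ⊆ Set.Icc a b → volume.real F ≤ δ * (b - a) →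
        (sliceMeasure w j y).real F ≤ κ * (sliceMeasure w j y).real (Set.Icc a b))
    {G : Set (Fin n → ℝ)} (hG : MeasurableSet G) :
    weightMeasure w (lineFill j δ G) ≤ ENNReal.ofReal (1 + 4 * κ) * weightMeasure w G := by
  rw [weightMeasure_eq_lintegral_sliceMeasure hw j (measurableSet_lineFill j δ hG),
    weightMeasure_eq_lintegral_sliceMeasure hw j hG, ← lintegral_const_mul' _ _ (by simp)]
  refine lintegral_mono_ae ?_
  filter_upwards [H] with y hy
  have := hy.1
  refine measure_le_of_forall_mem_Ioo _ hκ hκ1 hy.2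
    (measurable_insertCoord j y (measurableSet_lineFill j δ hG)) (measurable_insertCoord j y hG) ?_
  rintro t ⟨p, q, hpq, h⟩
  rw [insertCoord_same] at hpq
  simp only [update_insertCoord] at h
  exact ⟨p, q, hpq, h⟩

/-- The points of the box `[a, b]` whose chord parallel to the `j`-th axis meets `F` in at least a
proportion `δ`. -/
def chordThick {n : ℕ} (a b : Fin n → ℝ) (j : Fin n) (δ : ℝ) (F : Set (Fin n → ℝ)) :
    Set (Fin n → ℝ) :=
  {x | x ∈ Set.Icc a b ∧
    δ * (b j - a j) ≤ volume.real (Set.Icc (a j) (b j) ∩ {t | Function.update x j t ∈ F})}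

theorem measurableSet_chordThick {n : ℕ} (a b : Fin n → ℝ) (j : Fin n) (δ : ℝ)
    {F : Set (Fin n → ℝ)} (hF : MeasurableSet F) : MeasurableSet (chordThick a b j δ F) := by
  refine measurableSet_Icc.inter ?_
  have h := measurable_measure_prodMk_left (ν := (volume : Measure ℝ))
    ((measurable_snd measurableSet_Icc).inter (measurableSet_section_update j hF) :
      MeasurableSet ((Prod.snd ⁻¹' Set.Icc (a j) (b j)) ∩
        {p : (Fin n → ℝ) × ℝ | Function.update p.1 j p.2 ∈ F}))
  exact measurableSet_le measurable_const h.ennreal_toReal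

theorem mul_weightMeasure_chordThick_le {n : ℕ} {w : (Fin n → ℝ) → ℝ} (hw : Measurable w)
    {j : Fin n} {δ η : ℝ} (hη : 0 ≤ η)
    (H : ∀ᵐ y, IsLocallyFiniteMeasure (sliceMeasure w j y) ∧ ∀ a b F, a < b → MeasurableSet F →
      F ⊆ Set.Icc a b → δ * (b - a) ≤ volume.real F →
        η * (sliceMeasure w j y).real (Set.Icc a b) ≤ (sliceMeasure w j y).real F)
    {a b : Fin n → ℝ} (hab : a j < b j) {F : Set (Fin n → ℝ)} (hF : MeasurableSet F) :
    ENNReal.ofReal η * weightMeasure w (chordThick a b j δ F) ≤ weightMeasure w F := by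
  rw [weightMeasure_eq_lintegral_sliceMeasure hw j (measurableSet_chordThick a b j δ hF),
    weightMeasure_eq_lintegral_sliceMeasure hw j hF, ← lintegral_const_mul' _ _ (by simp)]
  refine lintegral_mono_ae ?_
  filter_upwards [H] with y hy
  have := hy.1
  set ν := sliceMeasure w j y
  rcases Set.eq_empty_or_nonempty {t | insertCoord j y t ∈ chordThick a b j δ F} with he | ⟨t, ht⟩
  · rw [he]; simp
  have hI : ν (Set.Icc (a j) (b j)) ≠ ∞ := isCompact_Icc.measure_lt_top.ne
  have hsub : {t | insertCoord j y t ∈ chordThick a b j δ F} ⊆ Set.Icc (a j) (b j) := fun s hs => by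
    have h1 := hs.1.1 j
    have h2 := hs.1.2 j
    rw [insertCoord_same] at h1 h2
    exact ⟨h1, h2⟩
  have h := ht.2
  simp only [update_insertCoord] at h
  have h1 := hy.2 (a j) (b j) _ hab (measurableSet_Icc.inter (measurable_insertCoord j y hF))
    Set.inter_subset_left h
  calc ENNReal.ofReal η * ν {t | insertCoord j y t ∈ chordThick a b j δ F}
      ≤ ENNReal.ofReal η * ν (Set.Icc (a j) (b j)) := by gcongr
    _ = ENNReal.ofReal (η * ν.real (Set.Icc (a j) (b j))) := by
        rw [ENNReal.ofReal_mul hη, ofReal_measureReal hI]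
    _ ≤ ENNReal.ofReal (ν.real (Set.Icc (a j) (b j) ∩ insertCoord j y ⁻¹' F)) :=
        ENNReal.ofReal_le_ofReal h1
    _ = ν (Set.Icc (a j) (b j) ∩ insertCoord j y ⁻¹' F) :=
        ofReal_measureReal (ne_top_of_le_ne_top hI (measure_mono Set.inter_subset_left))
    _ ≤ ν {t | insertCoord j y t ∈ F} := measure_mono Set.inter_subset_right

/-- Apply `lineFill` in the first `k` coordinate directions, one after the other. -/
def iterFill {n : ℕ} (δ : ℝ) (G : Set (Fin n → ℝ)) : ℕ → Set (Fin n → ℝ)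
  | 0 => G
  | k + 1 => if h : k < n then lineFill ⟨k, h⟩ δ (iterFill δ G k) else iterFill δ G k

/-- Apply `chordThick` in the first `k` coordinate directions, one after the other. -/
def iterThick {n : ℕ} (a b : Fin n → ℝ) (δ : ℝ) (F : Set (Fin n → ℝ)) : ℕ → Set (Fin n → ℝ)
  | 0 => F
  | k + 1 => if h : k < n then chordThick a b ⟨k, h⟩ δ (iterThick a b δ F k)
      else iterThick a b δ F k

theorem measurableSet_iterFill {n : ℕ} (δ : ℝ) {G : Set (Fin n → ℝ)} (hG : MeasurableSet G)
    (k : ℕ) : MeasurableSet (iterFill δ G k) := by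
  induction k with
  | zero => exact hG
  | succ k ih =>
    rw [iterFill]
    split_ifs
    · exact measurableSet_lineFill _ _ ih
    · exact ih

theorem measurableSet_iterThick {n : ℕ} (a b : Fin n → ℝ) (δ : ℝ) {F : Set (Fin n → ℝ)}
    (hF : MeasurableSet F) (k : ℕ) : MeasurableSet (iterThick a b δ F k) := by
  induction k with
  | zero => exact hF
  | succ k ih =>
    rw [iterThick]
    split_ifs
    · exact measurableSet_chordThick _ _ _ _ ih
    · exact ih

theorem weightMeasure_iterFill_le {n : ℕ} {w : (Fin n → ℝ) → ℝ} (hw : Measurable w)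
    {δ κ : ℝ} (hκ : 0 ≤ κ) (hκ1 : κ ≤ 1 / 4)
    (H : ∀ j, ∀ᵐ y, IsLocallyFiniteMeasure (sliceMeasure w j y) ∧ ∀ a b F, a < b →
      MeasurableSet F → F ⊆ Set.Icc a b → volume.real F ≤ δ * (b - a) →
        (sliceMeasure w j y).real F ≤ κ * (sliceMeasure w j y).real (Set.Icc a b))
    {G : Set (Fin n → ℝ)} (hG : MeasurableSet G) {k : ℕ} (hk : k ≤ n) :
    weightMeasure w (iterFill δ G k) ≤ ENNReal.ofReal (1 + 4 * κ) ^ k * weightMeasure w G := by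
  induction k with
  | zero => simp [iterFill]
  | succ k ih =>
    rw [iterFill, dif_pos (Nat.lt_of_succ_le hk), pow_succ', mul_assoc]
    refine (weightMeasure_lineFill_le hw hκ hκ1 (H _) (measurableSet_iterFill δ hG k)).trans ?_
    gcongr
    exact ih (Nat.le_of_succ_le hk)

theorem pow_mul_weightMeasure_iterThick_le {n : ℕ} {w : (Fin n → ℝ) → ℝ} (hw : Measurable w)
    {δ η : ℝ} (hη : 0 ≤ η)
    (H : ∀ j, ∀ᵐ y, IsLocallyFiniteMeasure (sliceMeasure w j y) ∧ ∀ a b F, a < b →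
      MeasurableSet F → F ⊆ Set.Icc a b → δ * (b - a) ≤ volume.real F →
        η * (sliceMeasure w j y).real (Set.Icc a b) ≤ (sliceMeasure w j y).real F)
    {a b : Fin n → ℝ} (hab : ∀ i, a i < b i) {F : Set (Fin n → ℝ)} (hF : MeasurableSet F)
    {k : ℕ} (hk : k ≤ n) :
    ENNReal.ofReal η ^ k * weightMeasure w (iterThick a b δ F k) ≤ weightMeasure w F := by
  induction k with
  | zero => simp [iterThick]
  | succ k ih =>
    rw [iterThick, dif_pos (Nat.lt_of_succ_le hk), pow_succ, mul_assoc]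
    refine le_trans ?_ (ih (Nat.le_of_succ_le hk))
    gcongr
    exact mul_weightMeasure_chordThick_le hw hη (H _) (hab _) (measurableSet_iterThick a b δ hF k)

theorem update_mem_Icc {n : ℕ} {a b x : Fin n → ℝ} (hx : x ∈ Set.Icc a b) {j : Fin n} {t : ℝ}
    (ht : t ∈ Set.Icc (a j) (b j)) : Function.update x j t ∈ Set.Icc a b :=
  ⟨le_update_iff.2 ⟨ht.1, fun i _ => hx.1 i⟩, update_le_iff.2 ⟨ht.2, fun i _ => hx.2 i⟩⟩

/-- Within the box, membership in `iterThick a b δ F k` does not depend on the first `k`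
coordinates. -/
theorem iterThick_congr {n : ℕ} {a b : Fin n → ℝ} {δ : ℝ} {F : Set (Fin n → ℝ)} {k : ℕ}
    (hk : k ≤ n) : ∀ {x x' : Fin n → ℝ}, x ∈ Set.Icc a b → x' ∈ Set.Icc a b →
      (∀ i : Fin n, k ≤ i → x i = x' i) → x ∈ iterThick a b δ F k → x' ∈ iterThick a b δ F k := by
  induction k with
  | zero =>
    intro x x' _ _ h hx
    rwa [← funext fun i => h i (Nat.zero_le _)]
  | succ k ih =>
    intro x x' hxR hxR' h hx
    rw [iterThick, dif_pos (Nat.lt_of_succ_le hk)] at hx ⊢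
    refine ⟨hxR', hx.2.trans (measureReal_mono ?_
      (ne_top_of_le_ne_top isCompact_Icc.measure_lt_top.ne (measure_mono Set.inter_subset_left)))⟩
    rintro t ⟨htI, ht⟩
    refine ⟨htI, ih (Nat.le_of_succ_le hk) (update_mem_Icc hxR htI) (update_mem_Icc hxR' htI) ?_ ht⟩
    intro i hi
    by_cases hik : i = ⟨k, Nat.lt_of_succ_le hk⟩
    · subst hik; simp
    · rw [Function.update_of_ne hik, Function.update_of_ne hik]
      refine h i (lt_of_le_of_ne hi fun he => hik (Fin.ext he.symm))

theorem diff_iterThick_subset_iterFill {n : ℕ} {a b : Fin n → ℝ} (hab : ∀ i, a i < b i) {δ : ℝ}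
    (hδ : 0 ≤ δ) {G : Set (Fin n → ℝ)} {k : ℕ} (hk : k ≤ n) :
    Set.Icc a b \ iterThick a b δ (Set.Icc a b \ G) k ⊆ iterFill δ G k := by
  induction k with
  | zero =>
    rintro x ⟨hx, hxG⟩
    by_contra h
    exact hxG ⟨hx, h⟩
  | succ k ih =>
    have hkn := Nat.lt_of_succ_le hk
    rintro x ⟨hx, hxT⟩
    rw [iterThick, dif_pos hkn] at hxT
    rw [iterFill, dif_pos hkn]
    set j : Fin n := ⟨k, hkn⟩
    set A := Set.Icc (a j) (b j) ∩
      {t | Function.update x j t ∈ iterThick a b δ (Set.Icc a b \ G) k} with hA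
    have hlt : volume.real A < δ * (b j - a j) := not_le.1 fun h => hxT ⟨hx, h⟩
    set e := (δ * (b j - a j) - volume.real A) / 2 with he
    have he0 : 0 < e := by rw [he]; linarith
    obtain ⟨p, hp1, hp2⟩ := exists_rat_btwn (show a j - e < a j by linarith)
    obtain ⟨q, hq1, hq2⟩ := exists_rat_btwn (show b j < b j + e by linarith)
    have hxj : a j ≤ x j ∧ x j ≤ b j := ⟨hx.1 j, hx.2 j⟩
    have hj := hab j
    refine ⟨p, q, ⟨by linarith, by linarith⟩, ?_⟩
    have hsub : Set.Icc (p : ℝ) q \ {t | Function.update x j t ∈ iterFill δ G k} ⊆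
        (A ∪ Set.Icc (p : ℝ) (a j)) ∪ Set.Icc (b j) q := by
      rintro t ⟨ht, htG⟩
      rcases le_total t (a j) with h1 | h1
      · exact Or.inl (Or.inr ⟨ht.1, h1⟩)
      rcases le_total (b j) t with h2 | h2
      · exact Or.inr ⟨h2, ht.2⟩
      refine Or.inl (Or.inl ⟨⟨h1, h2⟩, ?_⟩)
      by_contra h3
      exact htG (ih (Nat.le_of_succ_le hk) ⟨update_mem_Icc hx ⟨h1, h2⟩, h3⟩)
    have hAf : volume A ≠ ∞ := ne_top_of_le_ne_top isCompact_Icc.measure_lt_top.ne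
      (measure_mono Set.inter_subset_left)
    have h1 := measureReal_mono (μ := volume) hsub (by
      refine (measure_union_lt_top (measure_union_lt_top hAf.lt_top ?_) ?_).ne <;>
      exact isCompact_Icc.measure_lt_top)
    have h2 := measureReal_union_le (μ := volume) (A ∪ Set.Icc (p : ℝ) (a j)) (Set.Icc (b j) q)
    have h3 := measureReal_union_le (μ := volume) A (Set.Icc (p : ℝ) (a j))
    rw [Real.volume_real_Icc_of_le hp2.le] at h3
    rw [Real.volume_real_Icc_of_le hq1.le] at h2
    have h4 : δ * (b j - a j) ≤ δ * (q - p) := by gcongr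
    linarith

/-- A box which is sufficiently full of `G` is contained in the iterated filling of `G`. -/
theorem Icc_subset_iterFill {n : ℕ} {w : (Fin n → ℝ) → ℝ} (hw : Measurable w)
    {δ η : ℝ} (hδ : 0 ≤ δ) (hη : 0 ≤ η)
    (H : ∀ j, ∀ᵐ y, IsLocallyFiniteMeasure (sliceMeasure w j y) ∧ ∀ a b F, a < b →
      MeasurableSet F → F ⊆ Set.Icc a b → δ * (b - a) ≤ volume.real F →
        η * (sliceMeasure w j y).real (Set.Icc a b) ≤ (sliceMeasure w j y).real F)
    {a b : Fin n → ℝ} (hab : ∀ i, a i < b i) {G : Set (Fin n → ℝ)} (hG : MeasurableSet G)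
    (hlt : weightMeasure w (Set.Icc a b \ G) <
      ENNReal.ofReal η ^ n * weightMeasure w (Set.Icc a b)) :
    Set.Icc a b ⊆ iterFill δ G n := by
  intro x hx
  refine diff_iterThick_subset_iterFill hab hδ le_rfl ⟨hx, fun hxT => ?_⟩
  have hsub : Set.Icc a b ⊆ iterThick a b δ (Set.Icc a b \ G) n := fun x' hx' =>
    iterThick_congr le_rfl hx hx' (fun i hi => absurd i.2 (not_lt.2 hi)) hxT
  have h1 := pow_mul_weightMeasure_iterThick_le hw hη H hab
    ((measurableSet_Icc (a := a) (b := b)).diff hG) le_rfl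
  have h2 : ENNReal.ofReal η ^ n * weightMeasure w (Set.Icc a b) ≤
      ENNReal.ofReal η ^ n * weightMeasure w (iterThick a b δ (Set.Icc a b \ G) n) := by gcongr
  exact absurd hlt (not_lt.2 (h2.trans h1))

theorem maximalOne_congr_ae {f g : ℝ → ℝ} (h : f =ᵐ[volume] g) : maximalOne f = maximalOne g := by
  funext x
  unfold maximalOne
  have : ∀ a b : ℝ, ∫⁻ y in Set.Icc a b, ‖f y‖ₑ = ∫⁻ y in Set.Icc a b, ‖g y‖ₑ := fun a b =>
    lintegral_congr_ae (ae_restrict_of_ae (h.mono fun y hy => by simp only [hy]))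
  simp only [this]

theorem aInftyConst_congr_ae {v v' : ℝ → ℝ} (h : v =ᵐ[volume] v') :
    aInftyConst v = aInftyConst v' := by
  unfold aInftyConst
  have h1 : ∀ a b : ℝ, ∫⁻ x in Set.Icc a b, ENNReal.ofReal (v x) =
      ∫⁻ x in Set.Icc a b, ENNReal.ofReal (v' x) := fun a b =>
    lintegral_congr_ae (ae_restrict_of_ae (h.mono fun y hy => by simp only [hy]))
  have h2 : ∀ a b : ℝ, maximalOne ((Set.Icc a b).indicator v) =
      maximalOne ((Set.Icc a b).indicator v') := fun a b =>
    maximalOne_congr_ae (h.mono fun y hy => by simp only [Set.indicator_apply, hy])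
  simp only [h1, h2]

theorem ae_slice_ae_eq {n : ℕ} {w w' : (Fin n → ℝ) → ℝ} (h : w =ᵐ[volume] w') (j : Fin n) :
    ∀ᵐ y, slice w j y =ᵐ[volume] slice w' j y := by
  have h1 := (measurePreserving_insertCoord j).quasiMeasurePreserving.ae h
  exact Measure.ae_ae_of_ae_prod h1

theorem weightMeasure_lt_top_of_isCompact {n : ℕ} {w : (Fin n → ℝ) → ℝ}
    (hw : LocallyIntegrable w volume) {K : Set (Fin n → ℝ)} (hK : IsCompact K) :
    weightMeasure w K < ∞ := by
  rw [weightMeasure, withDensity_apply _ hK.measurableSet]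
  exact (hw.integrableOn_isCompact hK).lintegral_lt_top

theorem ae_isLocallyFiniteMeasure_sliceMeasure {n : ℕ} {w : (Fin n → ℝ) → ℝ} (hw : Measurable w)
    (hfin : ∀ K, IsCompact K → weightMeasure w K < ∞) (j : Fin n) :
    ∀ᵐ y, IsLocallyFiniteMeasure (sliceMeasure w j y) := by
  set B : ℕ → Set (Fin n → ℝ) := fun m => Set.Icc (fun _ => -(m : ℝ)) fun _ => (m : ℝ) with hB
  have hBm : ∀ m, MeasurableSet (B m) := fun m => measurableSet_Icc
  have h1 : ∀ m, ∀ᵐ y, sliceMeasure w j y {t | insertCoord j y t ∈ B m} < ∞ := fun m => by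
    have hm : Measurable fun p : ({i : Fin n // i ≠ j} → ℝ) × ℝ =>
        (B m).indicator (fun x => ENNReal.ofReal (w x)) (insertCoord j p.1 p.2) :=
      (hw.ennreal_ofReal.indicator (hBm m)).comp (measurePreserving_insertCoord j).measurable
    have he : ∀ y, sliceMeasure w j y {t | insertCoord j y t ∈ B m} =
        ∫⁻ t, (B m).indicator (fun x => ENNReal.ofReal (w x)) (insertCoord j y t) := fun y => by
      have hSy : MeasurableSet {t | insertCoord j y t ∈ B m} := measurable_insertCoord j y (hBm m)
      rw [sliceMeasure, withDensity_apply _ hSy, ← lintegral_indicator hSy]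
      rfl
    refine ae_lt_top ?_ ?_
    · simp only [he]
      exact hm.lintegral_prod_right'
    · rw [← weightMeasure_eq_lintegral_sliceMeasure hw j (hBm m)]
      exact (hfin _ isCompact_Icc).ne
  filter_upwards [ae_all_iff.2 h1] with y hy
  refine ⟨fun t => ?_⟩
  obtain ⟨M, hM⟩ := exists_nat_gt (|t| + ∑ i, |y i|)
  have hsum : 0 ≤ ∑ i, |y i| := Finset.sum_nonneg fun i _ => abs_nonneg _
  have ht : |t| < M := by linarith
  refine ⟨Set.Icc (-M) M, Icc_mem_nhds (neg_lt_of_abs_lt ht) (lt_of_abs_lt ht),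
    lt_of_le_of_lt (measure_mono fun s hs => ?_) (hy M)⟩
  have hi : ∀ i, -(M : ℝ) ≤ insertCoord j y s i ∧ insertCoord j y s i ≤ M := fun i => by
    by_cases h : i = j
    · subst h
      rwa [insertCoord_same]
    · rw [insertCoord_ne h, ← abs_le]
      have := Finset.single_le_sum (f := fun i => |y i|) (fun i _ => abs_nonneg _)
        (Finset.mem_univ ⟨i, h⟩)
      have := abs_nonneg t
      linarith
  exact ⟨fun i => (hi i).1, fun i => (hi i).2⟩

theorem IsStrongAInfty.exists_measurable {n : ℕ} {w : (Fin n → ℝ) → ℝ} (hw : IsStrongAInfty w) :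
    ∃ w' : (Fin n → ℝ) → ℝ, Measurable w' ∧ (∀ x, 0 ≤ w' x) ∧
      weightMeasure w' = weightMeasure w ∧
      ∀ j, ∀ᵐ y, IsLocallyFiniteMeasure (sliceMeasure w' j y) ∧
        aInftyConst (slice w' j y) ≤ strongAInftyConst w := by
  obtain ⟨g, hg, hwg⟩ := hw.locallyIntegrable.aestronglyMeasurable
  have hm : Measurable fun x => max (g x) 0 := hg.measurable.max measurable_const
  have hae : (fun x => max (g x) 0) =ᵐ[volume] w := hwg.mono fun x hx => by
    simp only [← hx]
    exact max_eq_left (hw.nonneg x)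
  have hμ : weightMeasure (fun x => max (g x) 0) = weightMeasure w :=
    withDensity_congr_ae (hae.mono fun x hx => by simp only at hx ⊢; rw [hx])
  refine ⟨_, hm, fun x => le_max_right _ _, hμ, fun j => ?_⟩
  filter_upwards [ae_isLocallyFiniteMeasure_sliceMeasure hm (fun K hK => hμ ▸
      weightMeasure_lt_top_of_isCompact hw.locallyIntegrable hK) j, ae_slice_ae_eq hae j,
    ENNReal.ae_le_essSup fun y => aInftyConst (slice w j y)] with y h1 h2 h3
  refine ⟨h1, ?_⟩
  rw [aInftyConst_congr_ae h2]
  exact h3.trans (le_iSup (fun j : Fin n =>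
    essSup (fun y : {i : Fin n // i ≠ j} → ℝ => aInftyConst (slice w j y)) volume) j)

/-- A bound for the Tauberian constant from two one-dimensional comparisons along the slices. -/
theorem tauberianConst_le {n : ℕ} {w w' : (Fin n → ℝ) → ℝ} (hw : Measurable w)
    (hww' : weightMeasure w = weightMeasure w')
    (hfin : ∀ K, IsCompact K → weightMeasure w K < ∞)
    {δ κ η α : ℝ} (hδ : 0 ≤ δ) (hκ : 0 ≤ κ) (hκ1 : κ ≤ 1 / 4) (hη : 0 ≤ η) (hα : 0 ≤ α)
    (hαη : 1 - α ≤ η ^ n)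
    (H : ∀ j, ∀ᵐ y, IsLocallyFiniteMeasure (sliceMeasure w j y) ∧ ∀ a b F, a < b →
      MeasurableSet F → F ⊆ Set.Icc a b →
        (volume.real F ≤ δ * (b - a) →
          (sliceMeasure w j y).real F ≤ κ * (sliceMeasure w j y).real (Set.Icc a b)) ∧
        (δ * (b - a) ≤ volume.real F →
          η * (sliceMeasure w j y).real (Set.Icc a b) ≤ (sliceMeasure w j y).real F)) :
    tauberianConst w' α ≤ ENNReal.ofReal ((1 + 4 * κ) ^ n) := by
  have H1 := fun j => (H j).mono fun y hy =>
    (⟨hy.1, fun a b F hab hF hFI => (hy.2 a b F hab hF hFI).1⟩ : _ ∧ _)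
  have H2 := fun j => (H j).mono fun y hy =>
    (⟨hy.1, fun a b F hab hF hFI => (hy.2 a b F hab hF hFI).2⟩ : _ ∧ _)
  unfold tauberianConst strongMaximal
  rw [← hww']
  refine iSup_le fun E => iSup_le fun hE => iSup_le fun _ => iSup_le fun _ =>
    ENNReal.div_le_of_le_mul ?_
  refine le_trans (measure_mono ?_) ((weightMeasure_iterFill_le hw hκ hκ1 H1 hE le_rfl).trans
    (le_of_eq (by rw [ENNReal.ofReal_pow (by linarith)])))
  intro x hx
  simp only [Set.mem_ofPred_eq, lt_iSup_iff] at hx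
  obtain ⟨a, b, hab, hxR, hlt⟩ := hx
  refine Icc_subset_iterFill hw hδ hη H2 hab hE ?_ hxR
  set μ := weightMeasure w
  have hR := (hfin _ (isCompact_Icc (a := a) (b := b))).ne
  have hint : ∫⁻ y in Set.Icc a b, ‖E.indicator (fun _ => (1 : ℝ)) y‖ₑ ∂μ =
      μ (Set.Icc a b ∩ E) := by
    have : ∀ y, ‖E.indicator (fun _ => (1 : ℝ)) y‖ₑ = E.indicator (fun _ => (1 : ℝ≥0∞)) y :=
      fun y => by by_cases hy : y ∈ E <;> simp [hy]
    simp only [this]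
    rw [lintegral_indicator_const hE, one_mul, Measure.restrict_apply hE, Set.inter_comm]
  rw [hint] at hlt
  have hR0 : μ (Set.Icc a b) ≠ 0 := fun h0 => by
    rw [measure_mono_null Set.inter_subset_left h0] at hlt
    simp at hlt
  rw [ENNReal.lt_div_iff_mul_lt (Or.inl hR0) (Or.inl hR)] at hlt
  have hRE := ne_top_of_le_ne_top hR (measure_mono (Set.inter_subset_left (s := Set.Icc a b) (t := E)))
  have hlt' := (ENNReal.toReal_lt_toReal (by finiteness) hRE).2 hlt
  rw [ENNReal.toReal_mul, ENNReal.toReal_ofReal hα] at hlt'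
  have hadd := measureReal_inter_add_sdiff (μ := μ) (s := Set.Icc a b) hE hR
  rw [← ENNReal.ofReal_pow hη, ← ofReal_measureReal hR, ← ENNReal.ofReal_mul (by positivity)]
  refine (ENNReal.lt_ofReal_iff_toReal_lt
    (ne_top_of_le_ne_top hR (measure_mono Set.sdiff_subset))).2 ?_
  have h1 := mul_le_mul_of_nonneg_right hαη (measureReal_nonneg (μ := μ) (s := Set.Icc a b))
  simp only [Measure.real] at *
  linarith

theorem one_add_pow_sub_one_le {x : ℝ} (hx : 0 ≤ x) (hx1 : x ≤ 1) (n : ℕ) :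
    (1 + x) ^ n - 1 ≤ 2 ^ n * x := by
  have h : (1 + x) ^ n ≤ 1 + (2 ^ n - 1) * x := by
    induction n with
    | zero => simp
    | succ n ih =>
      have h2 : (1 : ℝ) ≤ 2 ^ n := one_le_pow₀ (by norm_num)
      rw [pow_succ, pow_succ]
      have h3 : (2 ^ n - 1) * (x * x) ≤ (2 ^ n - 1) * (x * 1) := by
        have : (0 : ℝ) ≤ 2 ^ n - 1 := by linarith
        gcongr
      have h4 := mul_le_mul_of_nonneg_right ih (show 0 ≤ 1 + x by linarith)
      nlinarith
  nlinarith

/-- The Tauberian constants of a strong Muckenhoupt weight along a geometric sequence. -/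
theorem IsStrongAInfty.exists_tauberianConst_le {n : ℕ} {w : (Fin n → ℝ) → ℝ}
    (hw : IsStrongAInfty w) : ∃ ρ : ℝ, 0 < ρ ∧ ρ < 1 ∧ ∀ m : ℕ, 5 ≤ m → ∀ α : ℝ, 0 ≤ α →
      1 - α ≤ ρ ^ m → tauberianConst w α ≤ ENNReal.ofReal ((1 + 4 * (3 / 4) ^ m) ^ n) := by
  obtain ⟨w', hm, h0, hμ, hs⟩ := hw.exists_measurable
  have hA : strongAInftyConst w ≤ ENNReal.ofReal ((strongAInftyConst w).toReal + 1) := by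
    conv_lhs => rw [← ENNReal.ofReal_toReal hw.const_lt_top.ne]
    exact ENNReal.ofReal_le_ofReal (by linarith)
  obtain ⟨γ, hγ, hγ1, H⟩ := exists_power_comparison
    (show 0 < (strongAInftyConst w).toReal + 1 by positivity)
  obtain ⟨L, hL⟩ := exists_pow_lt_of_lt_one (show 0 < γ / 8 by positivity)
    (show 1 - γ / 2 < 1 by linarith)
  have hL0 : L ≠ 0 := fun h => by rw [h, pow_zero] at hL; linarith
  have hθ : 0 < 1 - γ / 2 := by linarith
  refine ⟨(1 / 16) ^ (L * (n + 1)), by positivity,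
    pow_lt_one₀ (by norm_num) (by norm_num) (by positivity), fun m hm5 α hα hαρ => ?_⟩
  have hκ : (3 / 4 : ℝ) ^ m ≤ 1 / 4 :=
    (pow_le_pow_of_le_one (by norm_num) (by norm_num) hm5).trans (by norm_num)
  refine tauberianConst_le (δ := 2 * (1 - γ / 2) ^ (L * m)) (η := (1 / 16) ^ (L * m)) hm hμ
    (fun K hK => hμ ▸ weightMeasure_lt_top_of_isCompact hw.locallyIntegrable hK) (by positivity)
    (by positivity) hκ (by positivity) hα (hαρ.trans ?_) fun j => ?_
  · rw [← pow_mul, ← pow_mul]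
    refine pow_le_pow_of_le_one (by norm_num) (by norm_num) ?_
    calc L * m * n ≤ L * m * (n + 1) := Nat.mul_le_mul_left _ (Nat.le_succ n)
      _ = L * (n + 1) * m := by ring
  · filter_upwards [hs j] with y hy
    refine ⟨hy.1, fun a b F hab hF hFI => ⟨fun h => ?_, fun h => ?_⟩⟩
    · refine (H (slice w' j y) (fun t => h0 _) (hy.2.trans hA) _ rfl hy.1 m a b F hab hF hFI).1
        (h.trans (mul_le_mul_of_nonneg_right ?_ (by linarith)))
      calc 2 * (1 - γ / 2) ^ (L * m) ≤ 2 ^ m * (1 - γ / 2) ^ (L * m) := by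
            gcongr
            exact le_self_pow₀ (by norm_num) (by omega)
        _ = (2 * (1 - γ / 2) ^ L) ^ m := by rw [pow_mul, mul_pow]
        _ ≤ (γ / 4) ^ m := by
            gcongr
            linarith
    · refine (H (slice w' j y) (fun t => h0 _) (hy.2.trans hA) _ rfl hy.1 (L * m) a b F hab hF
        hFI).2 (lt_of_lt_of_le ?_ h)
      have : 0 < (1 - γ / 2) ^ (L * m) * (b - a) := mul_pos (by positivity) (by linarith)
      linarith

theorem theorem3 {n : ℕ} (w : (Fin n → ℝ) → ℝ) (hw : IsStrongAInfty w) :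
    ∃ c : ℝ, 0 < c ∧ ∃ K : ℝ, 0 < K ∧
      ∀ᶠ α : ℝ in 𝓝[<] 1,
        tauberianConst w α - 1 ≤ ENNReal.ofReal (K * (1 - α) ^ c) := by
  obtain ⟨ρ, hρ, hρ1, H⟩ := hw.exists_tauberianConst_le
  have hc : 0 < Real.logb ρ (3 / 4) :=
    Real.logb_pos_of_base_lt_one hρ hρ1 (by norm_num) (by norm_num)
  refine ⟨Real.logb ρ (3 / 4), hc, 2 ^ n * 4 * (4 / 3), by positivity, ?_⟩
  have hρ5 : ρ ^ 5 < 1 := pow_lt_one₀ hρ.le hρ1 (by norm_num)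
  have hρ5' : 0 < ρ ^ 5 := by positivity
  filter_upwards [Ioo_mem_nhdsLT (show 1 - ρ ^ 5 < 1 by linarith)] with α hα
  obtain ⟨m, hm1, hm2⟩ := exists_nat_pow_near_of_lt_one (show 0 < 1 - α by linarith [hα.2])
    (show 1 - α ≤ 1 by linarith [hα.1]) hρ hρ1
  have hm5 : 5 ≤ m := by
    by_contra! h
    have := pow_le_pow_of_le_one hρ.le hρ1.le (show m + 1 ≤ 5 by omega)
    linarith [hα.1]
  have hκ : (3 / 4 : ℝ) ^ m ≤ 1 / 4 :=
    (pow_le_pow_of_le_one (by norm_num) (by norm_num) hm5).trans (by norm_num)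
  have hpow : (3 / 4 : ℝ) ^ (m + 1) ≤ (1 - α) ^ Real.logb ρ (3 / 4) := by
    calc (3 / 4 : ℝ) ^ (m + 1) = (ρ ^ Real.logb ρ (3 / 4)) ^ (m + 1) := by
          rw [Real.rpow_logb hρ hρ1.ne (by norm_num)]
      _ = (ρ ^ (m + 1)) ^ Real.logb ρ (3 / 4) := by
          rw [← Real.rpow_natCast, ← Real.rpow_mul hρ.le, mul_comm, Real.rpow_mul hρ.le,
            Real.rpow_natCast]
      _ ≤ _ := Real.rpow_le_rpow (by positivity) hm1.le hc.le
  calc tauberianConst w α - 1 ≤ ENNReal.ofReal ((1 + 4 * (3 / 4) ^ m) ^ n) - ENNReal.ofReal 1 := by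
        rw [ENNReal.ofReal_one]
        exact tsub_le_tsub_right (H m hm5 α (by linarith [hα.1]) hm2) _
    _ = ENNReal.ofReal ((1 + 4 * (3 / 4) ^ m) ^ n - 1) :=
        (ENNReal.ofReal_sub _ zero_le_one).symm
    _ ≤ _ := by
        refine ENNReal.ofReal_le_ofReal
          ((one_add_pow_sub_one_le (by positivity) (by linarith) n).trans ?_)
        rw [pow_succ] at hpow
        have h2 : (0 : ℝ) < 2 ^ n := by positivity
        have := mul_le_mul_of_nonneg_left hpow (show (0 : ℝ) ≤ 2 ^ n * 4 * (4 / 3) by positivity)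
        linarith
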